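/- **Setting.** A public transit network has stops, lines, trips and footpaths. All trips of a line $L$ visit the same stop sequence of length $|L|\ge 1$; the stop events of a trip $T$ are $T[1],\dots,T[|T|]$, with stop $p(T[i])$, arrival time $\tau_{\mathrm{arr}}(T[i])$ and departure time $\tau_{\mathrm{dep}}(T[i])$ in $\mathbb N$, where $\tau_{\mathrm{arr}}(T[i])\le\tau_{\mathrm{arr}}(T[i+1])$ and $\tau_{\mathrm{dep}}(T[i])\le\tau_{\mathrm{arr}}(T[i+1])$. There are finitely many lines and trips, and each stop has finitely many outgoing footpaths. The trips of a line are totally ordered by $\prec$, where $T\prec T'$ iff $T$ arrives and departs strictly before $T'$ at every index. Footpath times $w(p,q)\in\mathbb N\cup\{\infty\}$ ($\infty$ meaning: no footpath) satisfy $w(p,p)=0$ and the triangle inequality. A pair $(T_a[j],T_b[i])$ is a transfer if $\tau_{\mathrm{arr}}(T_a[j])+w(p(T_a[j]),p(T_b[i]))\le\tau_{\mathrm{dep}}(T_b[i])$. A journey is a sequence of trip segments $\langle T_1[i_1,j_1],\dots,T_k[i_k,j_k]\rangle$, entered at $T_n[i_n]$ and left at $T_n[j_n]$. For $m\le n$,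 its event subjourney from $\varepsilon_s=T_m[x]$ ($i_m\le x<j_m$) to $\varepsilon_t=T_n[y]$ ($i_n<y\le j_n$) is $J[\varepsilon_s,\varepsilon_t]=\langle T_m[x,j_m],\dots,T_n[i_n,y]\rangle$ (and $\langle T_m[x,y]\rangle$ with $x<y$ if $m=n$). **Preprocessing.** Transfers $(T_a[j],T_b[i])$ with $1<j$ and $i<|T_b|$ are generated, except those with $T_a\preceq T_b$ and $j\le i$, by one of two schemes: (W) $T_b$ is the earliest trip of its line for which $(T_a[j],T_b[i])$ is a transfer; or (L) there is no other transfer $(T_a[j'],T_c[i'])$ with $j'\ge j$, $i'\le i$, $T_c\preceq T_b$. Then two pruning rules are applied, first the U-turn rule, then the latest-exit rule, each exhaustively, removing transfers one at a time in an arbitrary order and always with respect to the current set $A$. The U-turn rule removes $(T_a[j],T_b[i])$ if $p(T_a[j-1])=p(T_b[i+1])$ and $(T_a[j-1],T_b[i+1])\in A$. The latest-exit rule removes $(T_a[j],T_b[i])$ if for every $l>i$ there are $(T_a[j'],T_c[i'])\in A$ with $j'>j$ and $l'>i'$ such that $\tau_{\mathrm{arr}}(T_c[l'])+w(p(T_c[l']),p(T_b[l]))\le\tau_{\mathrm{arr}}(T_b[l])$.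 The result is $\mathfrak T$. An order of examination is fixed for the footpaths out of each stop, for the lines, and for the transfers in $\mathfrak T$ out of each stop event. **Search.** The reached index $R(T)$ is initially $|T|+1$. Entering $T$ at $T[b]$ does nothing if $R(T)\le b+1$; otherwise it appends to the queue an element with exits $T[b+1],\dots,T[R(T)-1]$, with a pointer to the queue element it was reached from, and then sets $R(T')\leftarrow b+1$ for the trips $T'\succeq T$ of the line, in order, up to the first one with $R(T')\le b+1$. A TB query $(s,t,\tau)$ starts with $\tau_{\min}=\infty$, an empty Pareto front, and a first queue filled by entering, for every footpath $(s,p)$, every line and every index $i<|L|$ at which it visits $p$, the earliest trip $T$ of that line with $\tau+w(s,p)\le\tau_{\mathrm{dep}}(T[i])$. Round $n$ scans its queue in first-in-first-out order three times: (1) for each element, its exits $T[i]$ are examined in order, stopping at the first with $\tau_{\mathrm{arr}}(T[i])\ge\tau_{\min}$; whenever $a=\tau_{\mathrm{arr}}(T[i])+w(p(T[i]),t)<\tau_{\min}$, set $\tau_{\min}\leftarrow a$ and add the cost vector $(a,n)$ to the front, removing dominated ones; (2) each element is cut off at its first exit with $\tau_{\mathrm{arr}}(T[i])\ge\tau_{\min}$;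 (3) for each remaining exit, all its transfers in $\mathfrak T$ are relaxed, i.e. their target events are entered for the queue of round $n+1$. When the queue is empty, the journeys of the front are returned; they are unpacked by following the pointers, where the exit of the previous trip is the first exit of the previous element with a transfer to the event at which the trip was entered. An Event-TB search from a stop event $\varepsilon_s=T[b]$ starts with entering $T$ at $T[b]$ only, and performs only step (3) in each round. It *finds* the journey $K$ for $\varepsilon_t$ in round $n$ if some element of the queue of round $n$ has $\varepsilon_t$ among its exits and unpacking it from there yields $K$. **Theorem (subjourney closure).** Let $\mathfrak T$ be a transfer set computed by the preprocessing, let $J$ be a journey returned by TB for a query $(s,t,\tau)$, and let $J[\varepsilon_s,\varepsilon_t]$ be an event subjourney of $J$. If scheme (W) was used, assume moreover that $\tau_{\mathrm{arr}}(T[i])\le\tau_{\mathrm{dep}}(T[i])$ for all stop events, and that $J$ arrives at $t$ strictly before the time $\tau+w(s,t)$ at which one arrives by walking directly from $s$ (which is automatic if there is no footpath from $s$ to $t$). Then an Event-TB search from $\varepsilon_s$ finds exactly this subjourney for $\varepsilon_t$: it finds $J[\varepsilon_s,\varepsilon_t]$ in the round equal to its number of trip segments, and it finds no other journey for $\varepsilon_t$,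 in this or any other round. -/

import Mathlib

/-- A public transit network.  `Stop`, `Line`, `Trip` are the stops, lines and trips.
All trips of a line `ℓ` visit the same stops `stopAt ℓ 1, …, stopAt ℓ (len ℓ)`.  The stop event `T[i]`
of a trip `T` is represented by the pair `(T, i)` with `1 ≤ i ≤ len (line T)`; `arr T i` and
`dep T i` are its arrival and departure time.  `walk p q` is the traversal time of the footpath
`(p, q)`, and it is `⊤` if there is no such footpath. -/
structure Network (Stop Line Trip : Type*) where
  len : Line → ℕ
  stopAt : Line → ℕ → Stop
  line : Trip → Line
  /-- the trips of a line, from the earliest to the latest -/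
  trips : Line → List Trip
  arr : Trip → ℕ → ℕ
  dep : Trip → ℕ → ℕ
  walk : Stop → Stop → ℕ∞
  one_le_len : ∀ ℓ, 1 ≤ len ℓ
  mem_trips : ∀ ℓ T, T ∈ trips ℓ ↔ line T = ℓ
  /-- the trips of a line are totally ordered and never overtake each other -/
  trips_sorted : ∀ ℓ, (trips ℓ).Pairwise fun T T' =>
    ∀ i, 1 ≤ i → i ≤ len ℓ → arr T i < arr T' i ∧ dep T i < dep T' i
  arr_le_arr : ∀ T i, 1 ≤ i → i < len (line T) → arr T i ≤ arr T (i + 1)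
  dep_le_arr : ∀ T i, 1 ≤ i → i < len (line T) → dep T i ≤ arr T (i + 1)
  walk_self : ∀ p, walk p p = 0
  /-- triangle inequality; since `⊤` encodes a missing footpath, this includes transitive closure -/
  walk_triangle : ∀ p q r, walk p r ≤ walk p q + walk q r

/-- The trip segment `T[board, exit]`. -/
@[ext] structure TripSegment (Trip : Type*) where
  trip : Trip
  board : ℕ
  exit : ℕ

/-- A journey, as its sequence of trip segments.  The initial and the final footpath of a
stop-to-stop journey are determined by the two stops and the sequence. -/
abbrev Journey (Trip : Type*) := List (TripSegment Trip)

/-- `K` is the event subjourney `J[εs, εt]`: it starts at the stop event `εs` in some trip segment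
of `J` and ends at the stop event `εt` in the same or a later trip segment of `J`. -/
inductive IsEventSubjourney {Trip : Type*} (J : Journey Trip) :
    Trip × ℕ → Trip × ℕ → Journey Trip → Prop
  | within (A B : Journey Trip) (u : TripSegment Trip) (x y : ℕ) (hJ : J = A ++ [u] ++ B)
      (hx : u.board ≤ x) (hxy : x < y) (hy : y ≤ u.exit) :
      IsEventSubjourney J (u.trip, x) (u.trip, y) [⟨u.trip, x, y⟩]
  | across (A M B : Journey Trip) (u v : TripSegment Trip) (x y : ℕ)
      (hJ : J = A ++ [u] ++ M ++ [v] ++ B)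
      (hx : u.board ≤ x) (hx' : x < u.exit) (hy : v.board < y) (hy' : y ≤ v.exit) :
      IsEventSubjourney J (u.trip, x) (v.trip, y)
        ([⟨u.trip, x, u.exit⟩] ++ M ++ [⟨v.trip, v.board, y⟩])

namespace Network

variable {Stop Line Trip : Type*} (N : Network Stop Line Trip)

/-- The stop of the stop event `T[i]`. -/
def stopOf (e : Trip × ℕ) : Stop := N.stopAt (N.line e.1) e.2

/-- `T ≺ T'`. -/
def Precedes (T T' : Trip) : Prop :=
  N.line T = N.line T' ∧
    ∀ i, 1 ≤ i → i ≤ N.len (N.line T) → N.arr T i < N.arr T' i ∧ N.dep T i < N.dep T' i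

/-- `T ⪯ T'`. -/
def PrecedesEq (T T' : Trip) : Prop := N.Precedes T T' ∨ T = T'

def IsEvent (e : Trip × ℕ) : Prop := 1 ≤ e.2 ∧ e.2 ≤ N.len (N.line e.1)

/-- `(e, f)` is a transfer: there is a footpath and it is fast enough. -/
def IsTransfer (e f : Trip × ℕ) : Prop :=
  N.IsEvent e ∧ N.IsEvent f ∧
    (N.arr e.1 e.2 : ℕ∞) + N.walk (N.stopOf e) (N.stopOf f) ≤ N.dep f.1 f.2

/-- No trip dwells for a negative time. -/
def DwellNonneg : Prop := ∀ T i, 1 ≤ i → i ≤ N.len (N.line T) → N.arr T i ≤ N.dep T i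

/-! ### Transfer precomputation -/

/-- The transfers that enter the initial generation: the first event is not the first one of its
trip, the second event is not the last one of its trip, and it is not the case that both trips
belong to the same line and staying seated is preferable. -/
def IsCandidate (e f : Trip × ℕ) : Prop :=
  N.IsTransfer e f ∧ 1 < e.2 ∧ f.2 < N.len (N.line f.1) ∧ ¬ (N.PrecedesEq e.1 f.1 ∧ e.2 ≤ f.2)

end Network

/-- The two schemes for the initial transfer generation. -/
inductive GenScheme
  /-- only the earliest trip of each line that can be entered -/
  | earliestTrip
  /-- only transfers for which no transfer exists that has a later or equal exit from the same trip
  and a boarding of the same or an earlier trip of the same line at an earlier or equal index -/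
  | undominated

namespace Network

variable {Stop Line Trip : Type*} (N : Network Stop Line Trip)

/-- The initially generated transfer set. -/
def generated : GenScheme → Set ((Trip × ℕ) × (Trip × ℕ))
  | .earliestTrip => {t | N.IsCandidate t.1 t.2 ∧
      ∀ T, N.Precedes T t.2.1 → ¬ N.IsTransfer t.1 (T, t.2.2)}
  | .undominated => {t | N.IsCandidate t.1 t.2 ∧
      ∀ j T i, N.IsTransfer (t.1.1, j) (T, i) → t.1.2 ≤ j → i ≤ t.2.2 → N.PrecedesEq T t.2.1 →
        ((t.1.1, j), (T, i)) = t}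

/-- The U-turn rule allows to remove `t = (Ta[j], Tb[i])` from `A`:
`Ta[j-1]` and `Tb[i+1]` lie at the same stop and `(Ta[j-1], Tb[i+1]) ∈ A`. -/
def UTurn (A : Set ((Trip × ℕ) × (Trip × ℕ))) (t : (Trip × ℕ) × (Trip × ℕ)) : Prop :=
  N.stopOf (t.1.1, t.1.2 - 1) = N.stopOf (t.2.1, t.2.2 + 1) ∧
    ((t.1.1, t.1.2 - 1), (t.2.1, t.2.2 + 1)) ∈ A

/-- The latest-exit rule allows to remove `t = (Ta[j], Tb[i])` from `A`: for every exit `Tb[l]`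
there is a transfer `(Ta[j'], Tc[i']) ∈ A` with `j < j'` and an exit `Tc[l']` from which the stop of
`Tb[l]` is reached by a footpath not later than by `Tb`. -/
def LatestExit (A : Set ((Trip × ℕ) × (Trip × ℕ))) (t : (Trip × ℕ) × (Trip × ℕ)) : Prop :=
  ∀ l, t.2.2 < l → l ≤ N.len (N.line t.2.1) →
    ∃ j' Tc i' l', t.1.2 < j' ∧ ((t.1.1, j'), (Tc, i')) ∈ A ∧ i' < l' ∧ l' ≤ N.len (N.line Tc) ∧
      (N.arr Tc l' : ℕ∞) + N.walk (N.stopOf (Tc, l')) (N.stopOf (t.2.1, l)) ≤ N.arr t.2.1 l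

end Network

/-- `B` arises from `A` by exhaustively applying a pruning rule, which removes the transfers one by
one in an arbitrary order, each time with respect to the current set. -/
def PrunesTo {α : Type*} (rule : Set α → α → Prop) (A B : Set α) : Prop :=
  Relation.ReflTransGen (fun C D => ∃ t ∈ C, rule C t ∧ D = C \ {t}) A B ∧ ∀ t ∈ B, ¬ rule B t

/-- `𝔗` is a transfer set computed by the preprocessing: initial generation, then the U-turn rule,
then the latest-exit rule. -/
def Network.IsTransferSet {Stop Line Trip : Type*} (N : Network Stop Line Trip)
    (scheme : GenScheme) (𝔗 : Set ((Trip × ℕ) × (Trip × ℕ))) : Prop :=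
  ∃ A, PrunesTo N.UTurn (N.generated scheme) A ∧ PrunesTo N.LatestExit A 𝔗

/-- The fixed order in which the query algorithm examines the outgoing footpaths of a stop, the
lines, and the outgoing transfers of a stop event: duplicate-free enumerations. -/
structure ScanOrder {Stop Line Trip : Type*} (N : Network Stop Line Trip)
    (𝔗 : Set ((Trip × ℕ) × (Trip × ℕ))) where
  foot : Stop → List Stop
  lines : List Line
  out : Trip × ℕ → List (Trip × ℕ)
  foot_nodup : ∀ p, (foot p).Nodup
  mem_foot : ∀ p q, q ∈ foot p ↔ N.walk p q ≠ ⊤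
  lines_nodup : lines.Nodup
  mem_lines : ∀ ℓ, ℓ ∈ lines
  out_nodup : ∀ e, (out e).Nodup
  mem_out : ∀ e f, f ∈ out e ↔ (e, f) ∈ 𝔗

/-! ### Search -/

/-- A queue element: the trip `T` is entered at `T[board]`, and the exits
`T[board + 1], …, T[last]` are to be scanned.  An element that was enqueued by relaxing a transfer
carries a pointer to the queue element (of the previous round) from which this was done. -/
inductive QueueEntry (Trip : Type*)
  | root (trip : Trip) (board last : ℕ)
  | child (parent : QueueEntry Trip) (trip : Trip) (board last : ℕ)

namespace QueueEntry

variable {Trip : Type*}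

def trip : QueueEntry Trip → Trip
  | root T _ _ => T
  | child _ T _ _ => T

def board : QueueEntry Trip → ℕ
  | root _ b _ => b
  | child _ _ b _ => b

def last : QueueEntry Trip → ℕ
  | root _ _ k => k
  | child _ _ _ k => k

def setLast (k : ℕ) : QueueEntry Trip → QueueEntry Trip
  | root T b _ => root T b k
  | child p T b _ => child p T b k

/-- the exit indices `board + 1, …, last` -/
def exits (q : QueueEntry Trip) : List ℕ := List.range' (q.board + 1) (q.last - q.board)

/-- Journey unpacking for the exit `T[l]` of a queue element of the trip `T`.  The exit index of the
parent is recovered by rescanning the outgoing transfers of the parent and choosing the first one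
that leads to `T[board]` (it always exists). -/
def unpack [DecidableEq Trip] (out : Trip × ℕ → List (Trip × ℕ)) :
    QueueEntry Trip → ℕ → Journey Trip
  | root T b _, l => [⟨T, b, l⟩]
  | child p T b _, l =>
      unpack out p ((p.exits.find? fun i => decide ((T, b) ∈ out (p.trip, i))).getD 0) ++
        [⟨T, b, l⟩]

end QueueEntry

/-- Reached indices and the queue that is being filled. -/
structure SearchState (Trip : Type*) where
  reached : Trip → ℕ
  queue : List (QueueEntry Trip)

/-- An element of the tentative Pareto front: a cost vector (arrival time, number of trips) with a
pointer to the queue element and the exit index from which the final footpath was relaxed. -/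
structure FrontEntry (Trip : Type*) where
  arrival : ℕ∞
  rounds : ℕ
  entry : QueueEntry Trip
  exit : ℕ

/-- The cost vector of `c` dominates the one of `d`. -/
def FrontEntry.Dominates {Trip : Type*} (c d : FrontEntry Trip) : Prop :=
  c.arrival ≤ d.arrival ∧ c.rounds ≤ d.rounds ∧ (c.arrival < d.arrival ∨ c.rounds < d.rounds)

/-- Earliest known arrival time at the target and tentative Pareto front. -/
structure TargetState (Trip : Type*) where
  tmin : ℕ∞
  front : List (FrontEntry Trip)

namespace Network

variable {Stop Line Trip : Type*} [DecidableEq Stop] [DecidableEq Trip]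
  (N : Network Stop Line Trip)

/-- Nothing reached, empty queue. -/
def emptyState : SearchState Trip := ⟨fun T => N.len (N.line T) + 1, []⟩

/-- The enqueue operation for entering `T` at `T[b]`. -/
def enqueue (T : Trip) (b : ℕ) (parent : Option (QueueEntry Trip)) (σ : SearchState Trip) :
    SearchState Trip :=
  if σ.reached T ≤ b + 1 then σ
  else
    let last := σ.reached T - 1
    let new := match parent with
      | none => QueueEntry.root T b last
      | some p => QueueEntry.child p T b last
    -- `T` and the later trips of its line, up to the first one that was reached already
    let updated := ((N.trips (N.line T)).dropWhile fun T' => decide (T' ≠ T)).takeWhile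
      fun T' => decide (b + 1 < σ.reached T')
    ⟨fun T' => if T' ∈ updated then b + 1 else σ.reached T', σ.queue ++ [new]⟩

/-- Relaxes all outgoing transfers of the given queue elements, in order, into a new queue. -/
def relax (out : Trip × ℕ → List (Trip × ℕ)) (queue : List (QueueEntry Trip))
    (reached : Trip → ℕ) : SearchState Trip :=
  queue.foldl (fun σ q => q.exits.foldl (fun σ i => (out (q.trip, i)).foldl
    (fun σ f => N.enqueue f.1 f.2 (some q) σ) σ) σ) ⟨reached, []⟩

variable {𝔗 : Set ((Trip × ℕ) × (Trip × ℕ))} (ord : ScanOrder N 𝔗)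

open Classical in
/-- The first queue of a TB query with source stop `s` and departure time `τ`: for every stop `p`
reached from `s` by a footpath and every line at each of its visits of `p` (except at its last
stop), the earliest reachable trip is entered. -/
noncomputable def tbInit (s : Stop) (τ : ℕ) : SearchState Trip :=
  (ord.foot s).foldl (fun σ p => ord.lines.foldl (fun σ ℓ =>
    ((List.range' 1 (N.len ℓ - 1)).filter fun i => decide (N.stopAt ℓ i = p)).foldl (fun σ i =>
      match (N.trips ℓ).find? fun T => decide ((τ : ℕ∞) + N.walk s p ≤ N.dep T i) with
      | none => σ
      | some T => N.enqueue T i none σ) σ) σ) N.emptyState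

open Classical in
/-- First loop of a scan, for the queue element `q` in round `n`: runs through the exits, stops at
target pruning, and records every improvement of the arrival time at the target stop `t`. -/
noncomputable def scanTarget (t : Stop) (n : ℕ) (q : QueueEntry Trip) :
    List ℕ → TargetState Trip → TargetState Trip
  | [], ρ => ρ
  | i :: is, ρ =>
    if ρ.tmin ≤ N.arr q.trip i then ρ
    else
      let a : ℕ∞ := N.arr q.trip i + N.walk (N.stopOf (q.trip, i)) t
      if a < ρ.tmin then
        let new : FrontEntry Trip := ⟨a, n, q, i⟩
        scanTarget t n q is ⟨a, (ρ.front.filter fun c => decide (¬ new.Dominates c)) ++ [new]⟩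
      else scanTarget t n q is ρ

open Classical in
/-- Second loop of a scan: the queue element is cut off at its first exit that does not arrive
before `tmin`. -/
noncomputable def cutOff (tmin : ℕ∞) (q : QueueEntry Trip) : QueueEntry Trip :=
  match q.exits.find? fun i => decide (tmin ≤ (N.arr q.trip i : ℕ∞)) with
  | none => q
  | some i => q.setLast (i - 1)

/-- The state of the TB query from the stop `s` at departure time `τ` to the stop `t` after `n`
rounds.  The queue is the one for round `n + 1`. -/
noncomputable def tbState (s t : Stop) (τ : ℕ) : ℕ → SearchState Trip × TargetState Trip
  | 0 => (N.tbInit ord s τ, ⟨⊤, []⟩)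
  | n + 1 =>
    let (σ, ρ) := tbState s t τ n
    let ρ' := σ.queue.foldl (fun ρ q => N.scanTarget t (n + 1) q q.exits ρ) ρ
    (N.relax ord.out (σ.queue.map (N.cutOff ρ'.tmin)) σ.reached, ρ')

/-- `J` is a journey returned by TB for the query `(s, t, τ)`: when the queue has become empty, `J`
is unpacked from an element of the Pareto front. -/
def TBReturns (s t : Stop) (τ : ℕ) (J : Journey Trip) : Prop :=
  ∃ n, (N.tbState ord s t τ n).1.queue = [] ∧
    ∃ c ∈ (N.tbState ord s t τ n).2.front, J = c.entry.unpack ord.out c.exit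

/-- The state of the Event-TB search from the stop event `ε` after `n` rounds.  The queue is the one
for round `n + 1`.  The first queue consists of the rest of the trip of `ε`; there is no target and
no target pruning. -/
def eventTBState (ε : Trip × ℕ) : ℕ → SearchState Trip
  | 0 => N.enqueue ε.1 ε.2 none N.emptyState
  | n + 1 =>
    let σ := eventTBState ε n
    N.relax ord.out σ.queue σ.reached

/-- The Event-TB search from `εs` visits the stop event `εt` in round `n`, and `K` is the journey
that it finds for it. -/
def EventTBFinds (εs : Trip × ℕ) (n : ℕ) (εt : Trip × ℕ) (K : Journey Trip) : Prop :=
  ∃ m, n = m + 1 ∧ ∃ q ∈ (N.eventTBState ord εs m).queue,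
    q.trip = εt.1 ∧ q.board < εt.2 ∧ εt.2 ≤ q.last ∧ K = q.unpack ord.out εt.2

/-- The arrival time of a journey at the target stop `t`, including the final footpath
(`⊤` for the empty sequence of trip segments, which is not a journey). -/
def arrivalAt (t : Stop) (J : Journey Trip) : ℕ∞ :=
  match J.getLast? with
  | none => ⊤
  | some u => N.arr u.trip u.exit + N.walk (N.stopOf (u.trip, u.exit)) t

end Network

/-!
Why the event search from `T[x]` keeps pace with the query.

An event search cannot be obstructed on the subjourney unless it enters an earlier or equal trip of
the line of some segment, at an index before the exit `T[j]` of this segment, strictly before it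
gets there along the journey.  So it suffices to show that whatever an event search explores before
the current element of the subjourney is *dominated* (`Network.Dominated`) by what the TB query
explores before the corresponding element of the journey: at the stop of every event explored by the
former, one can be at least as early by walking from an exit explored by the latter.  If `T[j]` were
dominated in this sense, then so would be all later exits of the journey, and at last the target
would have been reached at least as early before the journey was found; but a journey is recorded
only if it improves the arrival time at the target.  Since "before" refers to the position in the
queue and not only to the round, this also settles ties between journeys of equal cost, whatever the
order in which transfers are examined.

Both comparisons rest on one fact, `Network.Dominated.transfer`: if a list `H` of queue elements
dominates an event and a transfer leads from there into a trip, then what is explored from `H`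
dominates the later events of this trip.  Its proof is by induction on the position of a queue
element in `H` and shows that the precomputed transfers suffice.

* Exits that a queue element does not offer are offered by an earlier element, for an earlier or
  equal trip of the line (`Network.RunInvariant`).
* A transfer removed by the latest-exit rule is replaced, for each exit, by one from a later event
  of the same trip (`Network.exists_latestExit`), so from an event after the one where the trip was
  entered.
* The U-turn rule never applies in the scheme `GenScheme.undominated`.  In the other scheme the
  chain of U-turns that replaces a transfer (`Network.exists_uTurn_chain`) may lead back to the
  event where the trip was entered.  Then entering this trip was a detour, and the transfer can be
  made from the parent queue element, or by walking from the source.  This is where nonnegative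
  dwell times are used, and why an arrival strictly before the direct walk is needed.

Target pruning does no harm, since all events involved arrive no later than the journey's last exit.
That nothing else is found holds because no stop event is an exit of two queue elements
(`Network.EventTBFinds.unique`).
-/

namespace Network

/-! ### The order on the trips of a line -/

section Order

variable {Stop Line Trip : Type*} (N : Network Stop Line Trip)

variable {N} in
theorem PrecedesEq.line_eq {T T' : Trip} (h : N.PrecedesEq T T') : N.line T = N.line T' := by
  rcases h with h | rfl
  · exact h.1
  · rfl

theorem PrecedesEq.refl (T : Trip) : N.PrecedesEq T T := Or.inr rfl

variable {N} in
theorem PrecedesEq.arr_le {T T' : Trip} (h : N.PrecedesEq T T') {i : ℕ} (h1 : 1 ≤ i)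
    (h2 : i ≤ N.len (N.line T)) : N.arr T i ≤ N.arr T' i := by
  rcases h with h | rfl
  · exact (h.2 i h1 h2).1.le
  · rfl

variable {N} in
theorem PrecedesEq.trans {T T' T'' : Trip} (h : N.PrecedesEq T T') (h' : N.PrecedesEq T' T'') :
    N.PrecedesEq T T'' := by
  rcases h with h | rfl
  · rcases h' with h' | rfl
    · refine Or.inl ⟨h.1.trans h'.1, fun i h1 h2 => ?_⟩
      have a := h.2 i h1 h2
      have b := h'.2 i h1 (h.1 ▸ h2)
      exact ⟨a.1.trans b.1, a.2.trans b.2⟩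
    · exact Or.inl h
  · exact h'

theorem not_precedes_self (T : Trip) : ¬ N.Precedes T T := fun h =>
  lt_irrefl _ (h.2 1 le_rfl (N.one_le_len _)).1

variable {N} in
theorem PrecedesEq.not_precedes {T T' : Trip} (h : N.PrecedesEq T T') : ¬ N.Precedes T' T := by
  rcases h with h | rfl
  · intro h'
    exact lt_asymm (h.2 1 le_rfl (N.one_le_len _)).1 (h'.2 1 le_rfl (N.one_le_len _)).1
  · exact N.not_precedes_self T

variable {N} in
theorem PrecedesEq.stopOf_eq {T T' : Trip} (h : N.PrecedesEq T T') (i : ℕ) :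
    N.stopOf (T, i) = N.stopOf (T', i) := by
  simp [stopOf, h.line_eq]

theorem arr_mono (T : Trip) {i j : ℕ} (hi : 1 ≤ i) (hij : i ≤ j) (hj : j ≤ N.len (N.line T)) :
    N.arr T i ≤ N.arr T j := by
  induction j, hij using Nat.le_induction with
  | base => rfl
  | succ j hij ih => exact (ih (by omega)).trans (N.arr_le_arr T j (by omega) (by omega))

theorem dep_le_arr_of_lt (T : Trip) {i j : ℕ} (hi : 1 ≤ i) (hij : i < j)
    (hj : j ≤ N.len (N.line T)) : N.dep T i ≤ N.arr T j :=
  (N.dep_le_arr T i hi (by omega)).trans (N.arr_mono T (by omega) hij hj)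

theorem precedes_of_append {T T' : Trip} {l₁ l₂ : List Trip}
    (h : N.trips (N.line T) = l₁ ++ T :: l₂) (hT' : T' ∈ l₂) : N.Precedes T T' := by
  have hs := N.trips_sorted (N.line T)
  have hl : N.line T' = N.line T := (N.mem_trips _ _).1 (by rw [h]; simp [hT'])
  rw [h, List.pairwise_append, List.pairwise_cons] at hs
  exact ⟨hl.symm, fun i h1 h2 => hs.2.1.1 T' hT' i h1 h2⟩

theorem precedes_of_append_left {T T' : Trip} {l₁ l₂ : List Trip}
    (h : N.trips (N.line T) = l₁ ++ T :: l₂) (hT' : T' ∈ l₁) : N.Precedes T' T := by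
  have hs := N.trips_sorted (N.line T)
  have hl : N.line T' = N.line T := (N.mem_trips _ _).1 (by rw [h]; simp [hT'])
  rw [h, List.pairwise_append] at hs
  exact ⟨hl, fun i h1 h2 => hs.2.2 T' hT' T (by simp) i h1 (hl ▸ h2)⟩

theorem mem_trips_append {T T' : Trip} {l₁ l₂ : List Trip}
    (h : N.trips (N.line T) = l₁ ++ T :: l₂) (hT' : N.PrecedesEq T T') : T' ∈ T :: l₂ := by
  have hm : T' ∈ N.trips (N.line T) := (N.mem_trips _ _).2 hT'.line_eq.symm
  rw [h] at hm
  rcases List.mem_append.1 hm with hm | hm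
  · exact absurd (N.precedes_of_append_left h hm) hT'.not_precedes
  · exact hm

end Order

/-! ### Covered exits and the invariant of a search -/

section Covers

variable {Stop Line Trip : Type*} (N : Network Stop Line Trip)

/-- The queue element for the trip `T`, entered at `T[b]`, with last exit `T[k]`. -/
def makeEntry (T : Trip) (b k : ℕ) : Option (QueueEntry Trip) → QueueEntry Trip
  | none => QueueEntry.root T b k
  | some p => QueueEntry.child p T b k

@[simp] theorem makeEntry_trip (T : Trip) (b k : ℕ) (p : Option (QueueEntry Trip)) :
    (makeEntry T b k p).trip = T := by cases p <;> rfl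

@[simp] theorem makeEntry_board (T : Trip) (b k : ℕ) (p : Option (QueueEntry Trip)) :
    (makeEntry T b k p).board = b := by cases p <;> rfl

@[simp] theorem makeEntry_last (T : Trip) (b k : ℕ) (p : Option (QueueEntry Trip)) :
    (makeEntry T b k p).last = k := by cases p <;> rfl

/-- Some element of `H` has the exit `T'[l]` for a trip `T' ⪯ T`. -/
def Covers (H : List (QueueEntry Trip)) (T : Trip) (l : ℕ) : Prop :=
  ∃ q ∈ H, N.PrecedesEq q.trip T ∧ q.board < l ∧ l ≤ q.last

variable {N} in
theorem Covers.mono {H H' : List (QueueEntry Trip)} {T : Trip} {l : ℕ} (h : N.Covers H T l)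
    (hs : ∀ q ∈ H, q ∈ H') : N.Covers H' T l := by
  obtain ⟨q, hq, h⟩ := h
  exact ⟨q, hs q hq, h⟩

variable {N} in
theorem Covers.trans {H : List (QueueEntry Trip)} {T T' : Trip} {l : ℕ} (h : N.Covers H T l)
    (hT : N.PrecedesEq T T') : N.Covers H T' l := by
  obtain ⟨q, hq, h1, h2⟩ := h
  exact ⟨q, hq, h1.trans hT, h2⟩

/-- What holds during a search for a state whose queue is the list of all queue elements that were
ever created: the reached index of `T` is the first exit index that is covered, and exits that were
not given to a new element are covered by earlier elements. -/
structure RunInvariant (σ : SearchState Trip) : Prop where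
  reached_le_len : ∀ T, σ.reached T ≤ N.len (N.line T) + 1
  covers : ∀ T l, σ.reached T ≤ l → l ≤ N.len (N.line T) → N.Covers σ.queue T l
  reached_le : ∀ q ∈ σ.queue, ∀ T, N.PrecedesEq q.trip T → σ.reached T ≤ q.board + 1
  bounds : ∀ q ∈ σ.queue, 1 ≤ q.board ∧ q.board < q.last ∧ q.last ≤ N.len (N.line q.trip)
  earlier : ∀ A q B, σ.queue = A ++ q :: B → ∀ l, q.last < l → l ≤ N.len (N.line q.trip) →
    N.Covers A q.trip l
  disjoint : ∀ A q B, σ.queue = A ++ q :: B → ∀ q' ∈ A, q'.trip = q.trip → q.last ≤ q'.board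

variable {N} in
theorem RunInvariant.antitone {σ : SearchState Trip} (h : N.RunInvariant σ) (T T' : Trip)
    (hT : N.PrecedesEq T T') : σ.reached T' ≤ σ.reached T := by
  rcases le_or_gt (σ.reached T) (N.len (N.line T)) with hl | hl
  · obtain ⟨q, hq, h1, h2, h3⟩ := h.covers T _ le_rfl hl
    exact (h.reached_le q hq T' (h1.trans hT)).trans h2
  · exact (h.reached_le_len T').trans (by rw [← hT.line_eq]; omega)

theorem runInvariant_emptyState : N.RunInvariant (N.emptyState) where
  reached_le_len T := le_rfl
  covers T l h h' := absurd h (by simp only [emptyState]; omega)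
  reached_le q hq := by simp [emptyState] at hq
  bounds q hq := by simp [emptyState] at hq
  earlier A q B h := by simp [emptyState] at h
  disjoint A q B h := by simp [emptyState] at h

variable {N} in
/-- No stop event is an exit of two queue elements. -/
theorem RunInvariant.unique {σ : SearchState Trip} (h : N.RunInvariant σ)
    {q q' : QueueEntry Trip} (hq : q ∈ σ.queue) (hq' : q' ∈ σ.queue) {l : ℕ}
    (ht : q.trip = q'.trip) (h1 : q.board < l) (h2 : l ≤ q.last) (h3 : q'.board < l)
    (h4 : l ≤ q'.last) : q = q' := by
  obtain ⟨A, B, hAB⟩ := List.append_of_mem hq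
  rw [hAB] at hq'
  rcases List.mem_append.1 hq' with hm | hm
  · have := h.disjoint A q B hAB q' hm ht.symm
    omega
  rcases List.mem_cons.1 hm with rfl | hm
  · rfl
  · obtain ⟨C, D, rfl⟩ := List.append_of_mem hm
    have := h.disjoint (A ++ q :: C) q' D (by rw [hAB]; simp) q (by simp) ht
    omega

end Covers

/-! ### Sequences of enqueue operations -/

section Run

variable {Stop Line Trip : Type*} [DecidableEq Trip] (N : Network Stop Line Trip)

/-- The trips of the line of `T` whose reached index is lowered when `T` is entered at `T[b]`. -/
def updatedTrips (T : Trip) (b : ℕ) (reached : Trip → ℕ) : List Trip :=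
  ((N.trips (N.line T)).dropWhile fun T' => decide (T' ≠ T)).takeWhile
    fun T' => decide (b + 1 < reached T')

theorem enqueue_of_le {T : Trip} {b : ℕ} {p : Option (QueueEntry Trip)} {σ : SearchState Trip}
    (h : σ.reached T ≤ b + 1) : N.enqueue T b p σ = σ := by
  simp [enqueue, h]

theorem enqueue_of_lt {T : Trip} {b : ℕ} {p : Option (QueueEntry Trip)} {σ : SearchState Trip}
    (h : b + 1 < σ.reached T) : N.enqueue T b p σ =
      ⟨fun T' => if T' ∈ N.updatedTrips T b σ.reached then b + 1 else σ.reached T',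
        σ.queue ++ [makeEntry T b (σ.reached T - 1) p]⟩ := by
  rw [enqueue, if_neg (by omega)]
  cases p <;> rfl

theorem dropWhile_trips (T : Trip) : ∃ l₁ l₂, N.trips (N.line T) = l₁ ++ T :: l₂ ∧
    (N.trips (N.line T)).dropWhile (fun T' => decide (T' ≠ T)) = T :: l₂ := by
  obtain ⟨l₁, l₂, h, hn⟩ := List.eq_append_cons_of_mem
    (show T ∈ N.trips (N.line T) from (N.mem_trips _ _).2 rfl)
  refine ⟨l₁, l₂, h, ?_⟩
  rw [h, List.dropWhile_append_of_pos]
  · simp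
  · intro a ha
    have : a ≠ T := by rintro rfl; exact hn ha
    simpa using this

theorem mem_updatedTrips {T T' : Trip} {b : ℕ} {reached : Trip → ℕ}
    (h : T' ∈ N.updatedTrips T b reached) : N.PrecedesEq T T' ∧ b + 1 < reached T' := by
  obtain ⟨l₁, l₂, h₁, h₂⟩ := N.dropWhile_trips T
  rw [updatedTrips, h₂] at h
  refine ⟨?_, by simpa using List.mem_takeWhile_imp h⟩
  rcases List.mem_cons.1 ((List.takeWhile_prefix _).subset h) with rfl | h
  · exact PrecedesEq.refl N _
  · exact Or.inl (N.precedes_of_append h₁ h)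

/-- If the reached index is antitone along each line, then every later trip with a large reached
index is updated: the scan does not stop before. -/
theorem mem_updatedTrips_of_lt {T T' : Trip} {b : ℕ} {reached : Trip → ℕ}
    (hanti : ∀ T T', N.PrecedesEq T T' → reached T' ≤ reached T)
    (h : N.PrecedesEq T T') (hb : b + 1 < reached T') : T' ∈ N.updatedTrips T b reached := by
  obtain ⟨l₁, l₂, h₁, h₂⟩ := N.dropWhile_trips T
  rw [updatedTrips, h₂]
  obtain ⟨t₁, t₂, ht⟩ := List.append_of_mem (N.mem_trips_append h₁ h)
  rw [ht, List.takeWhile_append_of_pos]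
  · simp [hb]
  · intro U hU
    have hl : N.trips (N.line T') = (l₁ ++ t₁) ++ T' :: t₂ := by
      rw [← h.line_eq, h₁, ht, List.append_assoc]
    have := N.precedes_of_append_left hl (List.mem_append_right _ hU)
    simpa using lt_of_lt_of_le hb (hanti _ _ (Or.inl this))

theorem self_mem_updatedTrips {T : Trip} {b : ℕ} {reached : Trip → ℕ} (hb : b + 1 < reached T) :
    T ∈ N.updatedTrips T b reached := by
  obtain ⟨l₁, l₂, h₁, h₂⟩ := N.dropWhile_trips T
  rw [updatedTrips, h₂]
  simp [hb]

theorem enqueue_reached_le (T : Trip) (b : ℕ) (p : Option (QueueEntry Trip))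
    (σ : SearchState Trip) (T' : Trip) : (N.enqueue T b p σ).reached T' ≤ σ.reached T' := by
  rcases le_or_gt (σ.reached T) (b + 1) with h | h
  · rw [N.enqueue_of_le h]
  · rw [N.enqueue_of_lt h]
    dsimp only
    split_ifs with hm
    · exact (N.mem_updatedTrips hm).2.le
    · rfl

theorem enqueue_reached_self_le (T : Trip) (b : ℕ) (p : Option (QueueEntry Trip))
    (σ : SearchState Trip) : (N.enqueue T b p σ).reached T ≤ b + 1 := by
  rcases le_or_gt (σ.reached T) (b + 1) with h | h
  · rwa [N.enqueue_of_le h]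
  · rw [N.enqueue_of_lt h]
    simp [N.self_mem_updatedTrips h]

/-- A request to enter a trip at a stop event, with the queue element it was reached from. -/
abbrev Op (Trip : Type*) := (Trip × ℕ) × Option (QueueEntry Trip)

/-- Performs a list of requests one after the other. -/
def run (σ : SearchState Trip) (ops : List (Op Trip)) : SearchState Trip :=
  ops.foldl (fun σ o => N.enqueue o.1.1 o.1.2 o.2 σ) σ

@[simp] theorem run_nil (σ : SearchState Trip) : N.run σ [] = σ := rfl

theorem run_append (σ : SearchState Trip) (l₁ l₂ : List (Op Trip)) :
    N.run σ (l₁ ++ l₂) = N.run (N.run σ l₁) l₂ := List.foldl_append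

theorem run_cons (σ : SearchState Trip) (o : Op Trip) (l : List (Op Trip)) :
    N.run σ (o :: l) = N.run (N.enqueue o.1.1 o.1.2 o.2 σ) l := rfl

theorem run_reached_le (σ : SearchState Trip) (ops : List (Op Trip)) (T : Trip) :
    (N.run σ ops).reached T ≤ σ.reached T := by
  induction ops generalizing σ with
  | nil => rfl
  | cons o l ih => exact (ih _).trans (N.enqueue_reached_le _ _ _ _ _)

theorem run_reached_le_of_mem (σ : SearchState Trip) {ops : List (Op Trip)} {o : Op Trip}
    (ho : o ∈ ops) : (N.run σ ops).reached o.1.1 ≤ o.1.2 + 1 := by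
  obtain ⟨l₁, l₂, rfl⟩ := List.append_of_mem ho
  rw [run_append, run_cons]
  exact (N.run_reached_le _ _ _).trans (N.enqueue_reached_self_le _ _ _ _)

/-- Which queue elements are created depends on the reached indices only. -/
theorem run_queue_append (R : Trip → ℕ) (H Q : List (QueueEntry Trip)) (ops : List (Op Trip)) :
    N.run ⟨R, H ++ Q⟩ ops = ⟨(N.run ⟨R, Q⟩ ops).reached, H ++ (N.run ⟨R, Q⟩ ops).queue⟩ := by
  induction ops generalizing R Q with
  | nil => rfl
  | cons o l ih =>
    rw [run_cons, run_cons]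
    rcases le_or_gt (R o.1.1) (o.1.2 + 1) with h | h
    · rw [N.enqueue_of_le (by exact h), N.enqueue_of_le (by exact h), ih]
    · rw [N.enqueue_of_lt (by exact h), N.enqueue_of_lt (by exact h)]
      dsimp only
      rw [List.append_assoc, ih]

theorem run_history (R : Trip → ℕ) (H : List (QueueEntry Trip)) (ops : List (Op Trip)) :
    N.run ⟨R, H⟩ ops = ⟨(N.run ⟨R, []⟩ ops).reached, H ++ (N.run ⟨R, []⟩ ops).queue⟩ := by
  simpa using N.run_queue_append R H [] ops

/-- A queue element stems from a request, and the elements before it from the requests before. -/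
theorem exists_op_of_queue_eq (R : Trip → ℕ) (ops : List (Op Trip))
    {A B : List (QueueEntry Trip)} {q : QueueEntry Trip}
    (h : (N.run ⟨R, []⟩ ops).queue = A ++ q :: B) :
    ∃ ops₁ o ops₂, ops = ops₁ ++ o :: ops₂ ∧ (N.run ⟨R, []⟩ ops₁).queue = A ∧
      o.1.2 + 1 < (N.run ⟨R, []⟩ ops₁).reached o.1.1 ∧
      q = makeEntry o.1.1 o.1.2 ((N.run ⟨R, []⟩ ops₁).reached o.1.1 - 1) o.2 := by
  induction ops using List.reverseRecOn generalizing B with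
  | nil => simp at h
  | append_singleton l o ih =>
    rw [run_append, run_cons, run_nil] at h
    rcases le_or_gt ((N.run ⟨R, []⟩ l).reached o.1.1) (o.1.2 + 1) with hr | hr
    · rw [N.enqueue_of_le hr] at h
      obtain ⟨l₁, o', l₂, rfl, h'⟩ := ih h
      exact ⟨l₁, o', l₂ ++ [o], by simp, h'⟩
    · rw [N.enqueue_of_lt hr] at h
      dsimp only at h
      rcases List.eq_nil_or_concat' B with rfl | ⟨B', b, rfl⟩
      · obtain ⟨h₁, h₂⟩ := List.append_inj' h rfl
        exact ⟨l, o, [], rfl, h₁, hr, by simpa using h₂.symm⟩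
      · have : (N.run ⟨R, []⟩ l).queue = A ++ q :: B' := by
          rw [← List.cons_append, ← List.append_assoc] at h
          exact (List.append_inj' h rfl).1
        obtain ⟨l₁, o', l₂, rfl, h'⟩ := ih this
        exact ⟨l₁, o', l₂ ++ [o], by simp, h'⟩

variable {N} in
theorem RunInvariant.enqueue {σ : SearchState Trip} (h : N.RunInvariant σ) (T : Trip) (b : ℕ)
    (p : Option (QueueEntry Trip)) (hb : 1 ≤ b) : N.RunInvariant (N.enqueue T b p σ) := by
  rcases le_or_gt (σ.reached T) (b + 1) with hr | hr
  · rwa [N.enqueue_of_le hr]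
  have hle := N.enqueue_reached_le T b p σ
  rw [N.enqueue_of_lt hr] at hle ⊢
  have hlast := h.reached_le_len T
  have key : ∀ {A q B}, σ.queue ++ [makeEntry T b (σ.reached T - 1) p] = A ++ q :: B →
      (A = σ.queue ∧ q = makeEntry T b (σ.reached T - 1) p) ∨
        ∃ B', σ.queue = A ++ q :: B' := by
    intro A q B hAB
    rcases List.eq_nil_or_concat' B with rfl | ⟨B', c, rfl⟩
    · obtain ⟨h₁, h₂⟩ := List.append_inj' hAB rfl
      exact Or.inl ⟨h₁.symm, by simpa using h₂.symm⟩
    · rw [← List.cons_append, ← List.append_assoc] at hAB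
      exact Or.inr ⟨B', (List.append_inj' hAB rfl).1⟩
  refine ⟨fun T' => (hle T').trans (h.reached_le_len T'), ?_, ?_, ?_, ?_, ?_⟩
  · intro T' l hl hl'
    by_cases hc : σ.reached T' ≤ l
    · exact (h.covers T' l hc hl').mono fun q hq => List.mem_append_left _ hq
    · dsimp only at hl
      split_ifs at hl with hm
      · have hT := (N.mem_updatedTrips hm).1
        have := h.antitone T T' hT
        refine ⟨_, List.mem_append_right _ (List.mem_singleton_self _), ?_, ?_, ?_⟩ <;> simp
        · exact hT
        · omega
        · omega
      · exact absurd hl hc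
  · intro q hq T' hT'
    rcases List.mem_append.1 hq with hq | hq
    · exact (hle T').trans (h.reached_le q hq T' hT')
    · rw [List.mem_singleton] at hq
      subst hq
      simp only [makeEntry_trip, makeEntry_board] at hT' ⊢
      split_ifs with hm
      · rfl
      · by_contra hlt
        exact hm (N.mem_updatedTrips_of_lt h.antitone hT' (by omega))
  · intro q hq
    rcases List.mem_append.1 hq with hq | hq
    · exact h.bounds q hq
    · rw [List.mem_singleton] at hq
      subst hq
      simp only [makeEntry_trip, makeEntry_board, makeEntry_last]
      omega
  · intro A q B hAB l hl hl'
    rcases key hAB with ⟨rfl, rfl⟩ | ⟨B', hB'⟩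
    · simp only [makeEntry_trip, makeEntry_last] at hl hl' ⊢
      exact h.covers T l (by omega) hl'
    · exact h.earlier A q B' hB' l hl hl'
  · intro A q B hAB q' hq' htrip
    rcases key hAB with ⟨rfl, rfl⟩ | ⟨B', hB'⟩
    · simp only [makeEntry_trip, makeEntry_last] at htrip ⊢
      have := h.reached_le q' hq' T (Or.inr htrip)
      omega
    · exact h.disjoint A q B' hB' q' hq' htrip

variable {N} in
theorem RunInvariant.run {σ : SearchState Trip} (h : N.RunInvariant σ) (ops : List (Op Trip))
    (hops : ∀ o ∈ ops, 1 ≤ o.1.2) : N.RunInvariant (N.run σ ops) := by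
  induction ops generalizing σ with
  | nil => exact h
  | cons o l ih =>
    exact ih (h.enqueue _ _ _ (hops o (by simp))) fun o' ho' => hops o' (by simp [ho'])

end Run

end Network

/-! ### What the transfer precomputation preserves -/

section Pruning

/-- Exhaustive pruning preserves every property of the current set that each single removal
preserves. -/
theorem PrunesTo.invariant {α : Type*} {rule : Set α → α → Prop} {A B : Set α}
    (h : PrunesTo rule A B) (P : Set α → Prop) (h0 : P A)
    (hstep : ∀ C t, P C → t ∈ C → rule C t → P (C \ {t})) : P B := by
  have := h.1
  clear h
  induction this with
  | refl => exact h0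
  | tail _ hs ih =>
    obtain ⟨t, ht, hr, rfl⟩ := hs
    exact hstep _ t ih ht hr

theorem PrunesTo.subset {α : Type*} {rule : Set α → α → Prop} {A B : Set α}
    (h : PrunesTo rule A B) : B ⊆ A :=
  h.invariant (fun C => C ⊆ A) subset_rfl fun _ _ hC _ _ => Set.sdiff_subset.trans hC

end Pruning

namespace Network

section Preprocessing

variable {Stop Line Trip : Type*} (N : Network Stop Line Trip)

/-- Arriving at the stop `p` at time `θ`, one can walk to the stop of `e` and be there no later
than `e` arrives. -/
def WalksTo (θ : ℕ) (p : Stop) (e : Trip × ℕ) : Prop :=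
  (θ : ℕ∞) + N.walk p (N.stopOf e) ≤ N.arr e.1 e.2

variable {N} in
theorem WalksTo.trans {θ : ℕ} {p : Stop} {e f : Trip × ℕ} (h : N.WalksTo θ p e)
    (h' : N.WalksTo (N.arr e.1 e.2) (N.stopOf e) f) : N.WalksTo θ p f := by
  unfold WalksTo at *
  calc (θ : ℕ∞) + N.walk p (N.stopOf f)
      ≤ θ + (N.walk p (N.stopOf e) + N.walk (N.stopOf e) (N.stopOf f)) := by
        gcongr; exact N.walk_triangle _ _ _
    _ = θ + N.walk p (N.stopOf e) + N.walk (N.stopOf e) (N.stopOf f) := (add_assoc _ _ _).symm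
    _ ≤ N.arr e.1 e.2 + N.walk (N.stopOf e) (N.stopOf f) := by gcongr
    _ ≤ _ := h'

theorem walksTo_of_stop_eq {θ : ℕ} {p : Stop} {e : Trip × ℕ} (hp : p = N.stopOf e)
    (h : θ ≤ N.arr e.1 e.2) : N.WalksTo θ p e := by
  subst hp
  simpa [WalksTo, N.walk_self] using h

variable {N} in
theorem WalksTo.le {θ : ℕ} {p : Stop} {e : Trip × ℕ} (h : N.WalksTo θ p e) :
    θ ≤ N.arr e.1 e.2 := by
  have : (θ : ℕ∞) ≤ N.arr e.1 e.2 := le_self_add.trans h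
  exact_mod_cast this

variable {N} in
/-- A transfer is still possible after arriving by a footpath. -/
theorem WalksTo.add_walk_le_dep {θ : ℕ} {p : Stop} {e f : Trip × ℕ} (h : N.WalksTo θ p e)
    (h' : N.IsTransfer e f) : (θ : ℕ∞) + N.walk p (N.stopOf f) ≤ N.dep f.1 f.2 :=
  calc (θ : ℕ∞) + N.walk p (N.stopOf f)
      ≤ θ + (N.walk p (N.stopOf e) + N.walk (N.stopOf e) (N.stopOf f)) := by
        gcongr; exact N.walk_triangle _ _ _
    _ = θ + N.walk p (N.stopOf e) + N.walk (N.stopOf e) (N.stopOf f) := (add_assoc _ _ _).symm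
    _ ≤ N.arr e.1 e.2 + N.walk (N.stopOf e) (N.stopOf f) := by gcongr; exact h
    _ ≤ _ := h'.2.2

variable {N} in
theorem PrecedesEq.walksTo {T T' : Trip} (h : N.PrecedesEq T T') {i : ℕ} (h1 : 1 ≤ i)
    (h2 : i ≤ N.len (N.line T)) : N.WalksTo (N.arr T i) (N.stopOf (T, i)) (T', i) :=
  N.walksTo_of_stop_eq (h.stopOf_eq i) (h.arr_le h1 h2)

variable {N} in
theorem IsTransfer.arr_le_dep {e f : Trip × ℕ} (h : N.IsTransfer e f) :
    N.arr e.1 e.2 ≤ N.dep f.1 f.2 := by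
  have : (N.arr e.1 e.2 : ℕ∞) ≤ N.dep f.1 f.2 := le_self_add.trans h.2.2
  exact_mod_cast this

variable {N} in
theorem IsTransfer.arr_le_arr {e f : Trip × ℕ} (h : N.IsTransfer e f) {l : ℕ} (hl : f.2 < l)
    (hl' : l ≤ N.len (N.line f.1)) : N.arr e.1 e.2 ≤ N.arr f.1 l :=
  h.arr_le_dep.trans (N.dep_le_arr_of_lt _ h.2.1.1 hl hl')

variable {N} in
theorem IsTransfer.of_precedesEq {T T' : Trip} {i : ℕ} {f : Trip × ℕ}
    (h : N.IsTransfer (T', i) f) (hT : N.PrecedesEq T T') : N.IsTransfer (T, i) f := by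
  have h1 : N.IsEvent (T, i) := ⟨h.1.1, by simpa [hT.line_eq] using h.1.2⟩
  exact ⟨h1, h.2.1, (hT.walksTo h1.1 h1.2).add_walk_le_dep h⟩

theorem isCandidate_of_mem_generated {scheme : GenScheme} {t : (Trip × ℕ) × (Trip × ℕ)}
    (h : t ∈ N.generated scheme) : N.IsCandidate t.1 t.2 := by
  cases scheme <;> exact h.1

theorem exists_earliest_trip (e : Trip × ℕ) (i : ℕ) (T : Trip) (h : N.IsTransfer e (T, i)) :
    ∃ T', N.PrecedesEq T' T ∧ N.IsTransfer e (T', i) ∧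
      ∀ T'', N.Precedes T'' T' → ¬ N.IsTransfer e (T'', i) := by
  induction hm : N.arr T 1 using Nat.strong_induction_on generalizing T with
  | _ m ih =>
    by_cases hT : ∃ T'', N.Precedes T'' T ∧ N.IsTransfer e (T'', i)
    · obtain ⟨T'', hp, ht⟩ := hT
      obtain ⟨T', h1, h2⟩ := ih _ (hm ▸ (hp.2 1 le_rfl (N.one_le_len _)).1) T'' ht rfl
      exact ⟨T', h1.trans (Or.inl hp), h2⟩
    · push Not at hT
      exact ⟨T, PrecedesEq.refl N T, h, hT⟩

theorem exists_undominated (Ta : Trip) (j : ℕ) (T : Trip) (i : ℕ)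
    (h : N.IsTransfer (Ta, j) (T, i)) :
    ∃ j' T' i', j ≤ j' ∧ i' ≤ i ∧ N.PrecedesEq T' T ∧ N.IsTransfer (Ta, j') (T', i') ∧
      ∀ j'' T'' i'', N.IsTransfer (Ta, j'') (T'', i'') → j' ≤ j'' → i'' ≤ i' →
        N.PrecedesEq T'' T' → ((Ta, j''), (T'', i'')) = ((Ta, j'), (T', i')) := by
  induction hm : (N.len (N.line Ta) - j) + i + N.arr T 1 using Nat.strong_induction_on
    generalizing j T i with
  | _ m ih =>
    by_cases hT : ∃ j'' T'' i'', N.IsTransfer (Ta, j'') (T'', i'') ∧ j ≤ j'' ∧ i'' ≤ i ∧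
        N.PrecedesEq T'' T ∧ ((Ta, j''), (T'', i'')) ≠ ((Ta, j), (T, i))
    · obtain ⟨j'', T'', i'', ht, hj, hi, hp, hne⟩ := hT
      have hlt : (N.len (N.line Ta) - j'') + i'' + N.arr T'' 1 < m := by
        have hb : j'' ≤ N.len (N.line Ta) := ht.1.2
        have ha := hp.arr_le le_rfl (N.one_le_len _)
        by_contra hge
        have e1 : j'' = j := by omega
        have e2 : i'' = i := by omega
        rcases hp with hp | rfl
        · have := (hp.2 1 le_rfl (N.one_le_len _)).1
          omega
        · exact hne (by rw [e1, e2])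
      obtain ⟨j', T', i', h1, h2, h3, h4⟩ := ih _ hlt j'' T'' i'' ht rfl
      exact ⟨j', T', i', hj.trans h1, h2.trans hi, h3.trans hp, h4⟩
    · push Not at hT
      exact ⟨j, T, i, le_rfl, le_rfl, PrecedesEq.refl N T, h, fun _ _ _ a b c d => hT _ _ _ a b c d⟩

/-- Every candidate transfer is represented by a generated one that leaves the same trip at the
same or a later index and enters the same line at the same or an earlier index, in the same or an
earlier trip. -/
theorem exists_generated (scheme : GenScheme) {Ta : Trip} {j : ℕ} {Tb : Trip} {i : ℕ}
    (h : N.IsCandidate (Ta, j) (Tb, i)) :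
    ∃ j' T' i', j ≤ j' ∧ i' ≤ i ∧ N.PrecedesEq T' Tb ∧
      ((Ta, j'), (T', i')) ∈ N.generated scheme := by
  obtain ⟨ht, hj, hi, hseat⟩ := h
  dsimp only at hj hi hseat
  cases scheme with
  | earliestTrip =>
    obtain ⟨T', h1, h2, h3⟩ := N.exists_earliest_trip _ _ _ ht
    refine ⟨j, T', i, le_rfl, le_rfl, h1, ⟨h2, hj, ?_, ?_⟩, h3⟩
    · simpa [h1.line_eq] using hi
    · exact fun hs => hseat ⟨hs.1.trans h1, hs.2⟩
  | undominated =>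
    obtain ⟨j', T', i', h1, h2, h3, h4, h5⟩ := N.exists_undominated _ _ _ _ ht
    refine ⟨j', T', i', h1, h2, h3, ⟨h4, hj.trans_le h1, ?_, ?_⟩,
      fun j'' T'' i'' => h5 j'' T'' i''⟩
    · simpa [h3.line_eq] using h2.trans_lt hi
    · exact fun hs => hseat ⟨hs.1.trans h3, h1.trans (hs.2.trans h2)⟩

/-- In the second generation scheme a transfer dominates the one by which the U-turn rule would
replace it, so the rule never applies. -/
theorem not_uTurn_of_undominated {C : Set ((Trip × ℕ) × (Trip × ℕ))}
    (hC : C ⊆ N.generated .undominated) {t : (Trip × ℕ) × (Trip × ℕ)} (ht : t ∈ C) :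
    ¬ N.UTurn C t := by
  rintro ⟨-, hu⟩
  have h := (hC hu).2 t.1.2 t.2.1 t.2.2 (hC ht).1.1 (Nat.sub_le _ _) (Nat.le_succ _)
    (PrecedesEq.refl N _)
  have : t.2.2 = t.2.2 + 1 := congrArg (fun t => t.2.2) h
  omega

/-- A transfer removed by the U-turn rule is replaced by one that arises from it by finitely many
U-turn steps; in the second generation scheme there are no such steps. -/
theorem exists_uTurn_chain {scheme : GenScheme} {A : Set ((Trip × ℕ) × (Trip × ℕ))}
    (hA : PrunesTo N.UTurn (N.generated scheme) A) {Ta : Trip} {j : ℕ} {Tb : Trip} {i : ℕ}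
    (h : ((Ta, j), (Tb, i)) ∈ N.generated scheme) :
    ∃ c, c < j ∧ (scheme = .undominated → c = 0) ∧ ((Ta, j - c), (Tb, i + c)) ∈ A ∧
      ∀ c', 1 ≤ c' → c' ≤ c → N.stopOf (Ta, j - c') = N.stopOf (Tb, i + c') := by
  refine (hA.invariant (fun C => C ⊆ N.generated scheme ∧
    ∃ c, c < j ∧ (scheme = .undominated → c = 0) ∧ ((Ta, j - c), (Tb, i + c)) ∈ C ∧
      ∀ c', 1 ≤ c' → c' ≤ c → N.stopOf (Ta, j - c') = N.stopOf (Tb, i + c'))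
    ⟨subset_rfl, 0, ?_, fun _ => rfl, h, fun c' h1 h2 => by omega⟩ ?_).2
  · exact (N.isCandidate_of_mem_generated h).2.1.trans' Nat.one_pos
  · rintro C t ⟨hC, c, hcj, hc0, hc, hsame⟩ ht hrule
    refine ⟨Set.sdiff_subset.trans hC, ?_⟩
    by_cases htc : ((Ta, j - c), (Tb, i + c)) = t
    · obtain ⟨hs, hm⟩ := hrule
      subst htc
      dsimp only at hs hm
      have hc1 : 1 < j - c := (N.isCandidate_of_mem_generated (hC hc)).2.1
      refine ⟨c + 1, by omega, ?_, ⟨?_, ?_⟩, ?_⟩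
      · rintro rfl
        exact absurd ⟨hs, hm⟩ (N.not_uTurn_of_undominated hC ht)
      · rwa [Nat.sub_add_eq, ← Nat.add_assoc]
      · intro he
        have : i + (c + 1) = i + c := congrArg (fun t => t.2.2) he
        omega
      · intro c' h1 h2
        rcases Nat.lt_or_ge c c' with h3 | h3
        · obtain rfl : c' = c + 1 := by omega
          rwa [Nat.sub_add_eq, ← Nat.add_assoc]
        · exact hsame c' h1 h3
    · exact ⟨c, hcj, hc0, ⟨hc, htc⟩, hsame⟩

/-- For each exit, a transfer removed by the latest-exit rule is replaced by one from the same or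
a later event of the first trip, by which the stop of that exit is reached in time. -/
theorem exists_latestExit {A B : Set ((Trip × ℕ) × (Trip × ℕ))} (h : PrunesTo N.LatestExit A B)
    {Ta : Trip} {j : ℕ} {Tb : Trip} {i l : ℕ} (ht : ((Ta, j), (Tb, i)) ∈ A) (hl : i < l)
    (hl' : l ≤ N.len (N.line Tb)) :
    ∃ j' Tc i' l', j ≤ j' ∧ ((Ta, j'), (Tc, i')) ∈ B ∧ i' < l' ∧ l' ≤ N.len (N.line Tc) ∧
      N.WalksTo (N.arr Tc l') (N.stopOf (Tc, l')) (Tb, l) := by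
  refine h.invariant (fun C => ∃ j' Tc i' l', j ≤ j' ∧ ((Ta, j'), (Tc, i')) ∈ C ∧ i' < l' ∧
    l' ≤ N.len (N.line Tc) ∧ N.WalksTo (N.arr Tc l') (N.stopOf (Tc, l')) (Tb, l))
    ⟨j, Tb, i, l, le_rfl, ht, hl, hl', N.walksTo_of_stop_eq rfl le_rfl⟩ ?_
  rintro C t ⟨j', Tc, i', l', hj', hm, hi', hl'', hw⟩ htC hrule
  by_cases he : ((Ta, j'), (Tc, i')) = t
  · subst he
    obtain ⟨j'', Td, i'', l''', h1, h2, h3, h4, h5⟩ := hrule l' hi' hl''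
    dsimp only at h1 h2 h5
    refine ⟨j'', Td, i'', l''', hj'.trans h1.le, ⟨h2, fun he => ?_⟩, h3, h4,
      WalksTo.trans (e := (Tc, l')) h5 hw⟩
    have : j'' = j' := congrArg (fun t => t.1.2) he
    omega
  · exact ⟨j', Tc, i', l', hj', ⟨hm, he⟩, hi', hl'', hw⟩

theorem IsTransferSet.isCandidate {scheme : GenScheme} {𝔗 : Set ((Trip × ℕ) × (Trip × ℕ))}
    (h : N.IsTransferSet scheme 𝔗) {t : (Trip × ℕ) × (Trip × ℕ)} (ht : t ∈ 𝔗) :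
    N.IsCandidate t.1 t.2 := by
  obtain ⟨A, hA, hB⟩ := h
  exact N.isCandidate_of_mem_generated (hA.subset (hB.subset ht))

end Preprocessing

/-! ### Domination by the explored part of a query -/

section Domination

variable {Stop Line Trip : Type*} (N : Network Stop Line Trip)

/-- From an exit of an element of `H` one can walk to the stop of `e` and be there no later than `e`
arrives.  With the first generation scheme it also suffices to walk there directly from the source
stop `s`, departing at time `τ`. -/
def Dominated (scheme : GenScheme) (s : Stop) (τ : ℕ) (H : List (QueueEntry Trip))
    (e : Trip × ℕ) : Prop :=
  (scheme = .earliestTrip ∧ N.WalksTo τ s e) ∨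
    ∃ q ∈ H, ∃ i, q.board < i ∧ i ≤ q.last ∧ N.WalksTo (N.arr q.trip i) (N.stopOf (q.trip, i)) e

/-- A list of queue elements as it arises in a query: each exit of a trip that a queue element does
not offer is covered before, and each queue element is entered from the source or by a transfer
from an earlier queue element. -/
structure IsHistory (𝔗 : Set ((Trip × ℕ) × (Trip × ℕ))) (s : Stop) (τ : ℕ)
    (H : List (QueueEntry Trip)) : Prop where
  bounds : ∀ q ∈ H, 1 ≤ q.board ∧ q.board < q.last ∧ q.last ≤ N.len (N.line q.trip)
  earlier : ∀ A q B, H = A ++ q :: B → ∀ l, q.last < l → l ≤ N.len (N.line q.trip) →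
    N.Covers A q.trip l
  origin : ∀ A q B, H = A ++ q :: B →
    (τ : ℕ∞) + N.walk s (N.stopOf (q.trip, q.board)) ≤ N.dep q.trip q.board ∨
      ∃ q' ∈ A, ∃ i, q'.board < i ∧ i ≤ q'.last ∧ ((q'.trip, i), (q.trip, q.board)) ∈ 𝔗

/-- `H'` contains what has to be explored from `H`: all transfers out of exits up to the arrival
time `a`, and all trips that can be entered from the source. -/
structure IsExpansion (𝔗 : Set ((Trip × ℕ) × (Trip × ℕ))) (s : Stop) (τ a : ℕ)
    (H H' : List (QueueEntry Trip)) : Prop where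
  mono : ∀ q ∈ H, q ∈ H'
  transfers : ∀ q ∈ H, ∀ i, q.board < i → i ≤ q.last → N.arr q.trip i ≤ a →
    ∀ f, ((q.trip, i), f) ∈ 𝔗 → ∀ l, f.2 < l → l ≤ N.len (N.line f.1) → N.Covers H' f.1 l
  source : ∀ f : Trip × ℕ, 1 ≤ f.2 → (τ : ℕ∞) + N.walk s (N.stopOf f) ≤ N.dep f.1 f.2 →
    ∀ l, f.2 < l → l ≤ N.len (N.line f.1) → N.Covers H' f.1 l

variable {N} {scheme : GenScheme} {𝔗 : Set ((Trip × ℕ) × (Trip × ℕ))} {s : Stop} {τ a : ℕ}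
  {H H' : List (QueueEntry Trip)}

theorem Dominated.mono {e : Trip × ℕ} (h : N.Dominated scheme s τ H e) (hs : ∀ q ∈ H, q ∈ H') :
    N.Dominated scheme s τ H' e := by
  rcases h with h | ⟨q, hq, h⟩
  · exact Or.inl h
  · exact Or.inr ⟨q, hs q hq, h⟩

theorem Dominated.trans {e f : Trip × ℕ} (h : N.Dominated scheme s τ H e)
    (hw : N.WalksTo (N.arr e.1 e.2) (N.stopOf e) f) : N.Dominated scheme s τ H f := by
  rcases h with ⟨h, h'⟩ | ⟨q, hq, i, h1, h2, h3⟩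
  · exact Or.inl ⟨h, h'.trans hw⟩
  · exact Or.inr ⟨q, hq, i, h1, h2, h3.trans hw⟩

theorem Covers.dominated {T : Trip} {l : ℕ} (h : N.Covers H T l) (hl : l ≤ N.len (N.line T)) :
    N.Dominated scheme s τ H (T, l) := by
  obtain ⟨q, hq, h1, h2, h3⟩ := h
  exact Or.inr ⟨q, hq, l, h2, h3, h1.walksTo (by omega) (by rwa [h1.line_eq])⟩

theorem IsHistory.covers (h : N.IsHistory 𝔗 s τ H) {q : QueueEntry Trip} (hq : q ∈ H) {l : ℕ}
    (h1 : q.board < l) (h2 : l ≤ N.len (N.line q.trip)) : N.Covers H q.trip l := by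
  rcases Nat.lt_or_ge q.last l with h3 | h3
  · obtain ⟨A, B, rfl⟩ := List.append_of_mem hq
    exact (h.earlier A q B rfl l h3 h2).mono fun q hq => List.mem_append_left _ hq
  · exact ⟨q, hq, PrecedesEq.refl N _, h1, h3⟩

theorem IsHistory.of_append {A B : List (QueueEntry Trip)} (h : N.IsHistory 𝔗 s τ (A ++ B)) :
    N.IsHistory 𝔗 s τ A where
  bounds q hq := h.bounds q (List.mem_append_left _ hq)
  earlier C q D hC := h.earlier C q (D ++ B) (by simp [hC])
  origin C q D hC := h.origin C q (D ++ B) (by simp [hC])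

/-- One round of exploration, from the exits of a queue element: the transfer set suffices to be
everywhere at least as early as by arbitrary transfers.  Induction on the position of the queue
element.  If a chain of U-turns leads back to the event at which the trip was entered, then the
transfer to this trip was a detour, and one transfers from the parent element (or from the source)
instead; here the trips must not dwell for a negative time. -/
theorem dominated_of_exit (h𝔗 : N.IsTransferSet scheme 𝔗)
    (hdwell : scheme = .earliestTrip → N.DwellNonneg)
    (hH : N.IsHistory 𝔗 s τ H) (hE : N.IsExpansion 𝔗 s τ a H H') :
    ∀ (n : ℕ) (A : List (QueueEntry Trip)) (q : QueueEntry Trip) (B : List (QueueEntry Trip)),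
      A.length = n → H = A ++ q :: B → ∀ j, q.board < j → j ≤ q.last →
      ∀ f, N.IsTransfer (q.trip, j) f → ∀ l, f.2 < l → l ≤ N.len (N.line f.1) →
      N.arr f.1 l ≤ a → N.Dominated scheme s τ H' (f.1, l) := by
  intro n
  induction n using Nat.strong_induction_on with
  | _ n ih =>
  intro A q B hn hAB j hbj hj f htr l hl hlen ha
  have hqH : q ∈ H := by simp [hAB]
  have hAH : ∀ q' ∈ A, q' ∈ H := fun q' h => by simp [hAB, h]
  have ihA : ∀ q' ∈ A, ∀ j, q'.board < j → j ≤ q'.last →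
      ∀ f, N.IsTransfer (q'.trip, j) f → ∀ l, f.2 < l → l ≤ N.len (N.line f.1) →
      N.arr f.1 l ≤ a → N.Dominated scheme s τ H' (f.1, l) := by
    intro q' hq'
    obtain ⟨A₁, A₂, rfl⟩ := List.append_of_mem hq'
    exact ih A₁.length (by rw [← hn]; simp) A₁ q' (A₂ ++ q :: B) rfl (by simp [hAB])
  obtain ⟨hb1, -, hqlen⟩ := hH.bounds q hqH
  -- transfers of the computed set, from all events after the one where the trip was entered
  have hset : ∀ j₂, q.board < j₂ → ∀ f₂, ((q.trip, j₂), f₂) ∈ 𝔗 → ∀ l₂, f₂.2 < l₂ →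
      l₂ ≤ N.len (N.line f₂.1) → N.arr f₂.1 l₂ ≤ a → N.Dominated scheme s τ H' (f₂.1, l₂) := by
    intro j₂ hj₂ f₂ hf₂ l₂ hl₂ hlen₂ ha₂
    have ht₂ : N.IsTransfer (q.trip, j₂) f₂ := (IsTransferSet.isCandidate N h𝔗 hf₂).1
    rcases Nat.lt_or_ge q.last j₂ with h | h
    · obtain ⟨q', hq', h1, h2, h3⟩ := hH.earlier A q B hAB j₂ h ht₂.1.2
      exact ihA q' hq' j₂ h2 h3 f₂ (ht₂.of_precedesEq h1) l₂ hl₂ hlen₂ ha₂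
    · exact (hE.transfers q hqH j₂ hj₂ h ((ht₂.arr_le_arr hl₂ hlen₂).trans ha₂) f₂ hf₂ l₂ hl₂
        hlen₂).dominated hlen₂
  have hlater : ∀ j₂, q.board < j₂ → j₂ ≤ N.len (N.line q.trip) →
      N.Dominated scheme s τ H' (q.trip, j₂) := fun j₂ h1 h2 =>
    ((hH.covers hqH h1 h2).dominated h2).mono hE.mono
  by_cases hseat : N.PrecedesEq q.trip f.1 ∧ j ≤ f.2
  · have h2 : l ≤ N.len (N.line q.trip) := by rwa [hseat.1.line_eq]
    have h1 : q.board < l := hbj.trans_le (hseat.2.trans hl.le)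
    exact (hlater l h1 h2).trans (hseat.1.walksTo (by omega) h2)
  obtain ⟨Tb, i⟩ := f
  dsimp only at hl hlen ha hseat ⊢
  have hcand : N.IsCandidate (q.trip, j) (Tb, i) := ⟨htr, by dsimp only; omega, by
    dsimp only; omega, hseat⟩
  obtain ⟨G, hG, hG'⟩ := h𝔗
  obtain ⟨j₁, Tb', i₁, hj₁, hi₁, hT, hgen⟩ := N.exists_generated scheme hcand
  obtain ⟨c, hcj, hc0, hcG, hsame⟩ := N.exists_uTurn_chain hG hgen
  have hc₁ : N.IsCandidate (q.trip, j₁) (Tb', i₁) := N.isCandidate_of_mem_generated hgen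
  have hc₂ : N.IsCandidate (q.trip, j₁ - c) (Tb', i₁ + c) :=
    N.isCandidate_of_mem_generated (hG.subset hcG)
  have hlen' : l ≤ N.len (N.line Tb') := by rwa [hT.line_eq]
  have hj₁len : j₁ ≤ N.len (N.line q.trip) := hc₁.1.1.2
  have hi₁1 : 1 ≤ i₁ := hc₁.1.2.1.1
  refine Dominated.trans (e := (Tb', l)) ?_ (hT.walksTo (by omega) hlen')
  have ha' : N.arr Tb' l ≤ a := (hT.arr_le (by omega) hlen').trans ha
  by_cases hcross : ∃ c', 1 ≤ c' ∧ c' ≤ c ∧ i₁ + c' ≤ l ∧ j₁ = q.board + c'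
  · obtain ⟨c', hc'1, hc'2, hc'3, hc'4⟩ := hcross
    have hscheme : scheme = .earliestTrip := by
      cases scheme
      · rfl
      · have := hc0 rfl
        omega
    have hst : N.stopOf (q.trip, q.board) = N.stopOf (Tb', i₁ + c') := by
      have := hsame c' hc'1 hc'2
      rwa [show j₁ - c' = q.board by omega] at this
    have hdep : N.dep q.trip q.board ≤ N.arr Tb' (i₁ + c') :=
      (N.dep_le_arr_of_lt _ hb1 (by omega) hj₁len).trans
        (hc₁.1.arr_le_arr (show i₁ < i₁ + c' by omega) (hc'3.trans hlen'))
    have hdep' : N.dep q.trip q.board ≤ N.dep Tb' (i₁ + c') :=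
      hdep.trans (hdwell hscheme Tb' _ (by omega) (hc'3.trans hlen'))
    rcases hH.origin A q B hAB with ho | ⟨q', hq', i', h1, h2, h3⟩
    · rw [hst] at ho
      rcases Nat.lt_or_ge (i₁ + c') l with hlt | hge
      · exact (hE.source (Tb', i₁ + c') (by dsimp only; omega)
          (ho.trans (by exact_mod_cast hdep')) l hlt hlen').dominated hlen'
      · obtain rfl : l = i₁ + c' := by omega
        exact Or.inl ⟨hscheme, ho.trans (by exact_mod_cast hdep)⟩
    · have ht₃ := (IsTransferSet.isCandidate N ⟨G, hG, hG'⟩ h3).1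
      have hw := ht₃.2.2
      dsimp only at hw
      rw [hst] at hw
      rcases Nat.lt_or_ge (i₁ + c') l with hlt | hge
      · exact ihA q' hq' i' h1 h2 (Tb', i₁ + c') ⟨ht₃.1, ⟨by dsimp only; omega, by
          dsimp only; omega⟩, hw.trans (by exact_mod_cast hdep')⟩ l hlt hlen' ha'
      · obtain rfl : l = i₁ + c' := by omega
        exact Or.inr ⟨q', hE.mono q' (hAH q' hq'), i', h1, h2,
          hw.trans (by exact_mod_cast hdep)⟩
  rcases Nat.lt_or_ge (i₁ + c) l with hlc | hlc
  · obtain ⟨j₂, Tc, i₂, l₂, h1, h2, h3, h4, h5⟩ := N.exists_latestExit hG' hcG hlc hlen'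
    have hjb : q.board < j₂ := by
      by_contra hle
      exact hcross ⟨j₁ - q.board, by omega, by omega, by omega, by omega⟩
    refine Dominated.trans (e := (Tc, l₂)) ?_ h5
    exact hset j₂ hjb (Tc, i₂) h2 l₂ h3 h4 (h5.le.trans ha')
  · -- the exit lies at a stop that the trip `q.trip` visits before the transfer
    have hjb : q.board < j₁ - (l - i₁) := by
      by_contra hle
      exact hcross ⟨j₁ - q.board, by omega, by omega, by omega, by omega⟩
    refine (hlater (j₁ - (l - i₁)) hjb (by omega)).trans (N.walksTo_of_stop_eq ?_ ?_)
    · have := hsame (l - i₁) (by omega) (by omega)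
      rwa [show i₁ + (l - i₁) = l by omega] at this
    · exact (N.arr_mono _ (by omega) (by omega) hj₁len).trans
        (hc₁.1.arr_le_arr (show i₁ < l by omega) hlen')

/-- One round of exploration: if `e` is dominated and `f` can be reached from `e` by a transfer,
then afterwards the later events of the trip of `f` are dominated. -/
theorem Dominated.transfer (h𝔗 : N.IsTransferSet scheme 𝔗)
    (hdwell : scheme = .earliestTrip → N.DwellNonneg)
    (hH : N.IsHistory 𝔗 s τ H) (hE : N.IsExpansion 𝔗 s τ a H H') {e f : Trip × ℕ}
    (h : N.Dominated scheme s τ H e) (ht : N.IsTransfer e f) {l : ℕ} (hl : f.2 < l)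
    (hlen : l ≤ N.len (N.line f.1)) (ha : N.arr f.1 l ≤ a) :
    N.Dominated scheme s τ H' (f.1, l) := by
  rcases h with ⟨-, h'⟩ | ⟨q, hq, i, h1, h2, h3⟩
  · exact (hE.source f ht.2.1.1 (h'.add_walk_le_dep ht) l hl hlen).dominated hlen
  · obtain ⟨A, B, hAB⟩ := List.append_of_mem hq
    refine dominated_of_exit h𝔗 hdwell hH hE _ A q B rfl hAB i h1 h2 f
      ⟨⟨by dsimp only; omega, ?_⟩, ht.2.1, h3.add_walk_le_dep ht⟩ l hl hlen ha
    exact h2.trans (hH.bounds q hq).2.2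

end Domination

/-! ### Searches by rounds -/

section Search

variable {Stop Line Trip : Type*} (N : Network Stop Line Trip)

/-- The requests made when the transfers out of the given exits of `q` are relaxed. -/
def exitRequests (out : Trip × ℕ → List (Trip × ℕ)) (q : QueueEntry Trip) (is : List ℕ) :
    List (Op Trip) :=
  is.flatMap fun i => (out (q.trip, i)).map fun f => (f, some q)

/-- The requests made when the transfers out of all exits of the given elements are relaxed. -/
def requests (out : Trip × ℕ → List (Trip × ℕ)) (Q : List (QueueEntry Trip)) : List (Op Trip) :=
  Q.flatMap fun q => exitRequests out q q.exits

/-- The queue elements of the first `n` rounds. -/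
def history (σ : ℕ → SearchState Trip) : ℕ → List (QueueEntry Trip)
  | 0 => []
  | n + 1 => history σ n ++ (σ n).queue

theorem mem_history {σ : ℕ → SearchState Trip} {n : ℕ} {q : QueueEntry Trip} :
    q ∈ history σ n ↔ ∃ k < n, q ∈ (σ k).queue := by
  induction n with
  | zero => simp [history]
  | succ n ih =>
    rw [history, List.mem_append, ih]
    constructor
    · rintro (⟨k, hk, h⟩ | h)
      · exact ⟨k, by omega, h⟩
      · exact ⟨n, by omega, h⟩
    · rintro ⟨k, hk, h⟩
      rcases Nat.lt_or_ge k n with hkn | hkn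
      · exact Or.inl ⟨k, hkn, h⟩
      · obtain rfl : k = n := by omega
        exact Or.inr h

theorem history_subset {σ : ℕ → SearchState Trip} {m n : ℕ} (h : m ≤ n) :
    ∀ q ∈ history σ m, q ∈ history σ n := by
  intro q hq
  obtain ⟨k, hk, hq⟩ := mem_history.1 hq
  exact mem_history.2 ⟨k, by omega, hq⟩

theorem mem_exits {q : QueueEntry Trip} {i : ℕ} : i ∈ q.exits ↔ q.board < i ∧ i ≤ q.last := by
  rw [QueueEntry.exits, List.mem_range'_1]
  omega

theorem mem_left_of_exits_eq {q : QueueEntry Trip} {is is' : List ℕ} {i : ℕ}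
    (h : q.exits = is ++ i :: is') (c : ℕ) : c ∈ is ↔ q.board < c ∧ c < i := by
  have hs : q.exits.Pairwise (· < ·) := List.pairwise_lt_range'
  have hi : i ∈ q.exits := by simp [h]
  have hc : c ∈ q.exits ↔ c ∈ is ∨ c = i ∨ c ∈ is' := by simp [h]
  rw [h, List.pairwise_append, List.pairwise_cons] at hs
  rw [mem_exits] at hi hc
  constructor
  · intro hm
    exact ⟨(hc.2 (Or.inl hm)).1, hs.2.2 c hm i (by simp)⟩
  · rintro ⟨h1, h2⟩
    rcases hc.1 ⟨h1, by omega⟩ with h | h | h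
    · exact h
    · omega
    · have := hs.2.1.1 c h
      omega

theorem mem_history_succ {σ : ℕ → SearchState Trip} {n : ℕ} {A B : List (QueueEntry Trip)}
    {q : QueueEntry Trip} (h : (σ n).queue = A ++ q :: B) : q ∈ history σ (n + 1) :=
  mem_history.2 ⟨n, Nat.lt_succ_self n, by simp [h]⟩

theorem mem_exitRequests {out : Trip × ℕ → List (Trip × ℕ)} {q : QueueEntry Trip} {is : List ℕ}
    {o : Op Trip} : o ∈ exitRequests out q is ↔
      ∃ i ∈ is, ∃ f ∈ out (q.trip, i), o = (f, some q) := by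
  simp [exitRequests, eq_comm]

theorem mem_requests {out : Trip × ℕ → List (Trip × ℕ)} {Q : List (QueueEntry Trip)}
    {o : Op Trip} : o ∈ requests out Q ↔
      ∃ q ∈ Q, ∃ i ∈ q.exits, ∃ f ∈ out (q.trip, i), o = (f, some q) := by
  simp [requests, mem_exitRequests]

theorem requests_append_cons (out : Trip × ℕ → List (Trip × ℕ)) {A B : List (QueueEntry Trip)}
    {q : QueueEntry Trip} {is is' : List ℕ} {i : ℕ} {fs fs' : List (Trip × ℕ)} {f : Trip × ℕ}
    (hq : q.exits = is ++ i :: is') (hi : out (q.trip, i) = fs ++ f :: fs') :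
    ∃ ops, requests out (A ++ q :: B) = (requests out A ++ (exitRequests out q is ++
      fs.map fun f => (f, some q))) ++ (f, some q) :: ops := by
  simp [requests, exitRequests, hq, hi]

theorem exists_split_of_flatMap_eq {α β : Type*} {l : List α} {g : α → List β} {A B : List β}
    {x : β} (h : l.flatMap g = A ++ x :: B) :
    ∃ l₁ a l₂ g₁ g₂, l = l₁ ++ a :: l₂ ∧ g a = g₁ ++ x :: g₂ ∧ A = l₁.flatMap g ++ g₁ := by
  induction l generalizing A with
  | nil => simp at h
  | cons a l ih =>
    rw [List.flatMap_cons, List.append_eq_append_iff] at h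
    rcases h with ⟨C, hA, hC⟩ | ⟨C, hg, hC⟩
    · obtain ⟨l₁, b, l₂, g₁, g₂, h1, h2, h3⟩ := ih hC
      exact ⟨a :: l₁, b, l₂, g₁, g₂, by simp [h1], h2, by simp [hA, h3]⟩
    · rcases C with _ | ⟨y, C⟩
      · obtain ⟨l₁, b, l₂, g₁, g₂, h1, h2, h3⟩ := ih (A := []) (by simpa using hC.symm)
        refine ⟨a :: l₁, b, l₂, g₁, g₂, by simp [h1], h2, ?_⟩
        simp only [List.append_nil] at hg
        rw [List.flatMap_cons, List.append_assoc, ← h3, hg, List.append_nil]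
      · obtain ⟨rfl, -⟩ : x = y ∧ B = C ++ l.flatMap g := by simpa using hC
        exact ⟨[], a, l, A, C, rfl, hg, by simp⟩

theorem exists_split_of_requests_eq {out : Trip × ℕ → List (Trip × ℕ)}
    {Q : List (QueueEntry Trip)} {ops ops' : List (Op Trip)} {o : Op Trip}
    (h : requests out Q = ops ++ o :: ops') :
    ∃ A q B is i is' fs fs', Q = A ++ q :: B ∧ q.exits = is ++ i :: is' ∧
      out (q.trip, i) = fs ++ o.1 :: fs' ∧ o.2 = some q ∧
      ops = requests out A ++ (exitRequests out q is ++ fs.map fun f => (f, some q)) := by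
  obtain ⟨A, q, B, o₁, o₂, h1, h2, h3⟩ := exists_split_of_flatMap_eq h
  obtain ⟨is, i, is', p₁, p₂, h4, h5, h6⟩ := exists_split_of_flatMap_eq h2
  obtain ⟨fs, r, h7, h8, h9⟩ := List.map_eq_append_iff.1 h5
  obtain ⟨f, fs', h10, h11, h12⟩ := List.map_eq_cons_iff.1 h9
  subst h11
  exact ⟨A, q, B, is, i, is', fs, fs', h1, h4, by rw [h7, h10], rfl, by
    rw [h3, h6, ← h8]; rfl⟩

variable [DecidableEq Trip]

theorem relax_eq_run (out : Trip × ℕ → List (Trip × ℕ)) (Q : List (QueueEntry Trip))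
    (R : Trip → ℕ) : N.relax out Q R = N.run ⟨R, []⟩ (requests out Q) := by
  simp only [relax, run, requests, exitRequests, List.foldl_flatMap, List.foldl_map]

/-- `σ` is the sequence of states of a search that starts with entering the stop events `roots` and
then relaxes the transfers `out` in rounds, where before the relaxation the queue elements of round
`n` are cut off according to `cut n`. -/
structure IsSearch (out : Trip × ℕ → List (Trip × ℕ)) (roots : List (Trip × ℕ))
    (cut : ℕ → QueueEntry Trip → QueueEntry Trip) (σ : ℕ → SearchState Trip) : Prop where
  zero : σ 0 = N.run N.emptyState (roots.map fun e => (e, none))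
  succ : ∀ n, σ (n + 1) = N.relax out ((σ n).queue.map (cut n)) (σ n).reached
  cut_trip : ∀ n q, (cut n q).trip = q.trip
  cut_board : ∀ n q, (cut n q).board = q.board
  cut_last_le : ∀ n q, (cut n q).last ≤ q.last
  cut_unpack : ∀ n q l, (cut n q).unpack out l = q.unpack out l
  one_le_of_mem_roots : ∀ e ∈ roots, 1 ≤ e.2
  one_le_of_mem_out : ∀ e, ∀ f ∈ out e, 1 ≤ f.2

namespace IsSearch

variable {N} {out : Trip × ℕ → List (Trip × ℕ)} {roots : List (Trip × ℕ)}
  {cut : ℕ → QueueEntry Trip → QueueEntry Trip} {σ : ℕ → SearchState Trip}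

theorem queue_succ (h : N.IsSearch out roots cut σ) (n : ℕ) :
    σ (n + 1) = N.run ⟨(σ n).reached, []⟩ (requests out ((σ n).queue.map (cut n))) := by
  rw [h.succ, relax_eq_run]

theorem one_le_of_mem_requests (h : N.IsSearch out roots cut σ) {Q : List (QueueEntry Trip)}
    {o : Op Trip} (ho : o ∈ requests out Q) : 1 ≤ o.1.2 := by
  obtain ⟨q, -, i, -, f, hf, rfl⟩ := mem_requests.1 ho
  exact h.one_le_of_mem_out _ f hf

theorem invariant (h : N.IsSearch out roots cut σ) (n : ℕ) :
    N.RunInvariant ⟨(σ n).reached, history σ (n + 1)⟩ := by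
  induction n with
  | zero =>
    have := (N.runInvariant_emptyState).run (roots.map fun e => (e, none)) (by
      intro o ho
      obtain ⟨e, he, rfl⟩ := List.mem_map.1 ho
      exact h.one_le_of_mem_roots e he)
    rw [← h.zero] at this
    exact this
  | succ n ih =>
    have := ih.run (requests out ((σ n).queue.map (cut n)))
      fun o ho => h.one_le_of_mem_requests ho
    rwa [run_history, ← h.queue_succ] at this

/-- The invariant while the requests of a round are performed. -/
theorem invariant_run (h : N.IsSearch out roots cut σ) (n : ℕ) {ops ops' : List (Op Trip)}
    (hops : requests out ((σ n).queue.map (cut n)) = ops ++ ops') :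
    N.RunInvariant ⟨(N.run ⟨(σ n).reached, []⟩ ops).reached,
      history σ (n + 1) ++ (N.run ⟨(σ n).reached, []⟩ ops).queue⟩ := by
  have := (h.invariant n).run ops fun o ho =>
    h.one_le_of_mem_requests (Q := (σ n).queue.map (cut n))
      (by rw [hops]; exact List.mem_append_left _ ho)
  rwa [run_history] at this

theorem mem_queue_zero (h : N.IsSearch out roots cut σ) {q : QueueEntry Trip}
    (hq : q ∈ (σ 0).queue) : ∃ e ∈ roots, ∃ k, q = QueueEntry.root e.1 e.2 k := by
  obtain ⟨A, B, hAB⟩ := List.append_of_mem hq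
  rw [h.zero] at hAB
  obtain ⟨ops₁, o, ops₂, h1, -, -, h2⟩ := N.exists_op_of_queue_eq _ _ hAB
  obtain ⟨e, he, rfl⟩ := List.mem_map.1 (show o ∈ roots.map fun e => (e, none) by rw [h1]; simp)
  exact ⟨e, he, _, h2⟩

/-- An element of the queue of a later round, together with the moment at which it is created. -/
theorem exists_parent (h : N.IsSearch out roots cut σ) {n : ℕ} {A B : List (QueueEntry Trip)}
    {q : QueueEntry Trip} (hq : (σ (n + 1)).queue = A ++ q :: B) :
    ∃ A₀ q₀ B₀ is i is' fs f fs' ops', (σ n).queue = A₀ ++ q₀ :: B₀ ∧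
      (cut n q₀).exits = is ++ i :: is' ∧ out (q₀.trip, i) = fs ++ f :: fs' ∧
      ∃ ops, ops = requests out (A₀.map (cut n)) ++ (exitRequests out (cut n q₀) is ++
        fs.map fun f => (f, some (cut n q₀))) ∧
      requests out ((σ n).queue.map (cut n)) = ops ++ (f, some (cut n q₀)) :: ops' ∧
      (N.run ⟨(σ n).reached, []⟩ ops).queue = A ∧
      f.2 + 1 < (N.run ⟨(σ n).reached, []⟩ ops).reached f.1 ∧
      q = QueueEntry.child (cut n q₀) f.1 f.2
        ((N.run ⟨(σ n).reached, []⟩ ops).reached f.1 - 1) := by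
  rw [h.queue_succ] at hq
  obtain ⟨ops, ⟨f, p⟩, ops', h1, h2, h3, h4⟩ := N.exists_op_of_queue_eq _ _ hq
  obtain ⟨A', q', B', is, i, is', fs, fs', h5, h6, h7, h8, h9⟩ := exists_split_of_requests_eq h1
  obtain ⟨A₀, r, h10, rfl, h12⟩ := List.map_eq_append_iff.1 h5
  obtain ⟨q₀, B₀, rfl, rfl, rfl⟩ := List.map_eq_cons_iff.1 h12
  dsimp only at h8
  subst h8
  rw [h.cut_trip] at h7
  exact ⟨A₀, q₀, B₀, is, i, is', fs, f, fs', ops', h10, h6, h7, ops, h9, h1, h2, h3, h4⟩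

theorem mem_exits_of_cut (h : N.IsSearch out roots cut σ) {n : ℕ} {q : QueueEntry Trip} {i : ℕ}
    (hi : i ∈ (cut n q).exits) : q.board < i ∧ i ≤ q.last := by
  rw [mem_exits, h.cut_board] at hi
  exact ⟨hi.1, hi.2.trans (h.cut_last_le n q)⟩

/-- After a transfer has been relaxed, the exits of its trip are covered. -/
theorem covers_of_mem_requests (h : N.IsSearch out roots cut σ) {n : ℕ}
    {ops ops' : List (Op Trip)} (hops : requests out ((σ n).queue.map (cut n)) = ops ++ ops')
    {o : Op Trip} (ho : o ∈ ops) {l : ℕ} (hl : o.1.2 < l) (hlen : l ≤ N.len (N.line o.1.1)) :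
    N.Covers (history σ (n + 1) ++ (N.run ⟨(σ n).reached, []⟩ ops).queue) o.1.1 l :=
  (h.invariant_run n hops).covers o.1.1 l
    ((N.run_reached_le_of_mem _ ho).trans hl) hlen

theorem covers_of_mem_out (h : N.IsSearch out roots cut σ) {n : ℕ} {q : QueueEntry Trip}
    (hq : q ∈ (σ n).queue) {i : ℕ} (hi : i ∈ (cut n q).exits) {f : Trip × ℕ}
    (hf : f ∈ out (q.trip, i)) {l : ℕ} (hl : f.2 < l) (hlen : l ≤ N.len (N.line f.1)) :
    N.Covers (history σ (n + 2)) f.1 l := by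
  have := h.covers_of_mem_requests (List.append_nil _).symm (o := (f, some (cut n q)))
    (mem_requests.2 ⟨cut n q, List.mem_map_of_mem hq, i, hi, f, by rwa [h.cut_trip], rfl⟩) hl hlen
  rwa [← h.queue_succ] at this

end IsSearch

variable {N}

theorem IsSearch.isHistory {out : Trip × ℕ → List (Trip × ℕ)} {roots : List (Trip × ℕ)}
    {cut : ℕ → QueueEntry Trip → QueueEntry Trip} {σ : ℕ → SearchState Trip}
    (h : N.IsSearch out roots cut σ) {𝔗 : Set ((Trip × ℕ) × (Trip × ℕ))} {s : Stop} {τ : ℕ}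
    (hout : ∀ e, ∀ f ∈ out e, (e, f) ∈ 𝔗)
    (hroots : ∀ e ∈ roots, (τ : ℕ∞) + N.walk s (N.stopOf e) ≤ N.dep e.1 e.2) (n : ℕ) :
    N.IsHistory 𝔗 s τ (history σ (n + 1)) := by
  refine ⟨(h.invariant n).bounds, (h.invariant n).earlier, ?_⟩
  -- it suffices to treat the elements of the last round
  suffices hlast : ∀ m A q B, history σ m = A ++ q :: B →
      (τ : ℕ∞) + N.walk s (N.stopOf (q.trip, q.board)) ≤ N.dep q.trip q.board ∨
        ∃ q' ∈ A, ∃ i, q'.board < i ∧ i ≤ q'.last ∧ ((q'.trip, i), (q.trip, q.board)) ∈ 𝔗 from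
    hlast (n + 1)
  intro m
  induction m with
  | zero => simp [history]
  | succ m ih =>
    intro A q B hAB
    rw [history, List.append_eq_append_iff] at hAB
    have hnew : ∀ C, (σ m).queue = C ++ q :: B → A = history σ m ++ C →
        (τ : ℕ∞) + N.walk s (N.stopOf (q.trip, q.board)) ≤ N.dep q.trip q.board ∨
        ∃ q' ∈ A, ∃ i, q'.board < i ∧ i ≤ q'.last ∧
          ((q'.trip, i), (q.trip, q.board)) ∈ 𝔗 := by
      intro C hC hA
      cases m with
      | zero =>
        obtain ⟨e, he, k, rfl⟩ := h.mem_queue_zero (q := q) (by simp [hC])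
        exact Or.inl (hroots e he)
      | succ m =>
        obtain ⟨A₀, q₀, B₀, is, i, is', fs, f, fs', ops', h1, h2, h3, ops, h4, h5, h6, h7, h8⟩ :=
          h.exists_parent hC
        have hi := h.mem_exits_of_cut (n := m) (q := q₀) (i := i) (by simp [h2])
        refine Or.inr ⟨q₀, ?_, i, hi.1, hi.2, ?_⟩
        · rw [hA, history, h1]
          simp
        · rw [h8]
          exact hout (q₀.trip, i) f (by simp [h3])
    rcases hAB with ⟨C, hA, hC⟩ | ⟨C, hH, hC⟩
    · exact hnew C hC hA
    · rcases C with _ | ⟨y, C⟩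
      · exact hnew [] (by simpa using hC.symm) (by simpa using hH.symm)
      · obtain ⟨rfl, -⟩ : q = y ∧ B = C ++ (σ m).queue := by simpa using hC
        exact ih A q C hH

end Search

/-! ### Scanning for the target -/

section Scan

variable {Stop Line Trip : Type*} (N : Network Stop Line Trip)

/-- The arrival time at the stop `t`, when walking there from the exit `T[i]` of `q`. -/
def arrivalFrom (t : Stop) (q : QueueEntry Trip) (i : ℕ) : ℕ∞ :=
  N.arr q.trip i + N.walk (N.stopOf (q.trip, i)) t

theorem scanTarget_tmin_le (t : Stop) (n : ℕ) (q : QueueEntry Trip) (is : List ℕ)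
    (ρ : TargetState Trip) : (N.scanTarget t n q is ρ).tmin ≤ ρ.tmin := by
  induction is generalizing ρ with
  | nil => rfl
  | cons i is ih =>
    simp only [scanTarget]
    split_ifs with h1 h2
    · rfl
    · exact (ih _).trans h2.le
    · exact ih _

theorem scanTarget_tmin_le_arrivalFrom (t : Stop) (n : ℕ) (q : QueueEntry Trip) (is : List ℕ)
    (his : is.Pairwise fun i j => N.arr q.trip i ≤ N.arr q.trip j)
    (ρ : TargetState Trip) {i : ℕ} (hi : i ∈ is) :
    (N.scanTarget t n q is ρ).tmin ≤ N.arrivalFrom t q i := by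
  induction is generalizing ρ with
  | nil => simp at hi
  | cons j is ih =>
    rw [List.pairwise_cons] at his
    simp only [scanTarget]
    split_ifs with h1 h2
    · have : N.arr q.trip j ≤ N.arr q.trip i := by
        rcases List.mem_cons.1 hi with rfl | hi
        · rfl
        · exact his.1 i hi
      exact (h1.trans (by exact_mod_cast this)).trans le_self_add
    · rcases List.mem_cons.1 hi with rfl | hi
      · exact N.scanTarget_tmin_le _ _ _ _ _
      · exact ih his.2 _ hi
    · rcases List.mem_cons.1 hi with rfl | hi
      · exact (N.scanTarget_tmin_le _ _ _ _ _).trans (not_lt.1 h2)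
      · exact ih his.2 _ hi

theorem mem_front_scanTarget (t : Stop) (n : ℕ) (q : QueueEntry Trip) (is : List ℕ)
    (ρ : TargetState Trip) {c : FrontEntry Trip} (hc : c ∈ (N.scanTarget t n q is ρ).front) :
    c ∈ ρ.front ∨ c.entry = q ∧ c.exit ∈ is ∧ N.arrivalFrom t q c.exit < ρ.tmin := by
  induction is generalizing ρ with
  | nil => exact Or.inl hc
  | cons i is ih =>
    simp only [scanTarget] at hc
    split_ifs at hc with h1 h2
    · exact Or.inl hc
    · rcases ih _ hc with h | ⟨h3, h4, h5⟩
      · rcases List.mem_append.1 h with h | h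
        · exact Or.inl (List.mem_of_mem_filter h)
        · rw [List.mem_singleton] at h
          subst h
          exact Or.inr ⟨rfl, by simp, h2⟩
      · exact Or.inr ⟨h3, by simp [h4], h5.trans h2⟩
    · rcases ih _ hc with h | ⟨h3, h4, h5⟩
      · exact Or.inl h
      · exact Or.inr ⟨h3, by simp [h4], h5⟩

/-- The first loop of a scan, for a whole queue. -/
noncomputable def scanQueue (t : Stop) (n : ℕ) (Q : List (QueueEntry Trip))
    (ρ : TargetState Trip) : TargetState Trip :=
  Q.foldl (fun ρ q => N.scanTarget t n q q.exits ρ) ρ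

theorem scanQueue_append (t : Stop) (n : ℕ) (A B : List (QueueEntry Trip))
    (ρ : TargetState Trip) :
    N.scanQueue t n (A ++ B) ρ = N.scanQueue t n B (N.scanQueue t n A ρ) := List.foldl_append

theorem scanQueue_cons (t : Stop) (n : ℕ) (q : QueueEntry Trip) (B : List (QueueEntry Trip))
    (ρ : TargetState Trip) :
    N.scanQueue t n (q :: B) ρ = N.scanQueue t n B (N.scanTarget t n q q.exits ρ) := rfl

theorem scanQueue_tmin_le (t : Stop) (n : ℕ) (Q : List (QueueEntry Trip))
    (ρ : TargetState Trip) : (N.scanQueue t n Q ρ).tmin ≤ ρ.tmin := by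
  induction Q generalizing ρ with
  | nil => rfl
  | cons q Q ih => exact (ih _).trans (N.scanTarget_tmin_le _ _ _ _ _)

theorem pairwise_exits {q : QueueEntry Trip} (h1 : 1 ≤ q.board)
    (h2 : q.last ≤ N.len (N.line q.trip)) :
    q.exits.Pairwise fun i j => N.arr q.trip i ≤ N.arr q.trip j := by
  have hs : q.exits.Pairwise (· < ·) := List.pairwise_lt_range'
  refine (List.pairwise_iff_forall_sublist).2 fun {i j} hij => ?_
  have hlt := (List.pairwise_iff_forall_sublist).1 hs hij
  have hi := mem_exits.1 (hij.subset (show i ∈ [i, j] by simp))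
  have hj := mem_exits.1 (hij.subset (show j ∈ [i, j] by simp))
  exact N.arr_mono _ (by omega) hlt.le (hj.2.trans h2)

theorem scanQueue_tmin_le_arrivalFrom (t : Stop) (n : ℕ) (Q : List (QueueEntry Trip))
    (ρ : TargetState Trip) {q : QueueEntry Trip} (hq : q ∈ Q) (h1 : 1 ≤ q.board)
    (h2 : q.last ≤ N.len (N.line q.trip)) {i : ℕ} (hi : i ∈ q.exits) :
    (N.scanQueue t n Q ρ).tmin ≤ N.arrivalFrom t q i := by
  obtain ⟨A, B, rfl⟩ := List.append_of_mem hq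
  rw [scanQueue_append, scanQueue_cons]
  exact (N.scanQueue_tmin_le _ _ _ _).trans
    (N.scanTarget_tmin_le_arrivalFrom _ _ _ _ (N.pairwise_exits h1 h2) _ hi)

theorem mem_front_scanQueue (t : Stop) (n : ℕ) (Q : List (QueueEntry Trip))
    (ρ : TargetState Trip) {c : FrontEntry Trip} (hc : c ∈ (N.scanQueue t n Q ρ).front) :
    c ∈ ρ.front ∨ ∃ A B, Q = A ++ c.entry :: B ∧ c.exit ∈ c.entry.exits ∧
      N.arrivalFrom t c.entry c.exit < (N.scanQueue t n A ρ).tmin := by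
  induction Q using List.reverseRecOn with
  | nil => exact Or.inl hc
  | append_singleton Q q ih =>
    rw [scanQueue_append, scanQueue_cons] at hc
    rcases N.mem_front_scanTarget _ _ _ _ _ hc with h | ⟨rfl, h⟩
    · rcases ih h with h | ⟨A, B, h1, h2⟩
      · exact Or.inl h
      · exact Or.inr ⟨A, B ++ [q], by simp [h1], h2⟩
    · exact Or.inr ⟨Q, [], rfl, h⟩

theorem cutOff_eq_or (tmin : ℕ∞) (q : QueueEntry Trip) : N.cutOff tmin q = q ∨
    ∃ i, i ∈ q.exits ∧ tmin ≤ (N.arr q.trip i : ℕ∞) ∧ N.cutOff tmin q = q.setLast (i - 1) := by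
  rw [cutOff]
  split
  · exact Or.inl rfl
  · next i h =>
    exact Or.inr ⟨i, List.mem_of_find?_eq_some h, by simpa using List.find?_some h, rfl⟩

theorem cutOff_trip (tmin : ℕ∞) (q : QueueEntry Trip) : (N.cutOff tmin q).trip = q.trip := by
  rcases N.cutOff_eq_or tmin q with h | ⟨i, -, -, h⟩ <;> rw [h]
  cases q <;> rfl

theorem cutOff_board (tmin : ℕ∞) (q : QueueEntry Trip) : (N.cutOff tmin q).board = q.board := by
  rcases N.cutOff_eq_or tmin q with h | ⟨i, -, -, h⟩ <;> rw [h]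
  cases q <;> rfl

theorem setLast_last (k : ℕ) (q : QueueEntry Trip) : (q.setLast k).last = k := by
  cases q <;> rfl

theorem cutOff_unpack [DecidableEq Trip] (out : Trip × ℕ → List (Trip × ℕ)) (tmin : ℕ∞)
    (q : QueueEntry Trip) (l : ℕ) : (N.cutOff tmin q).unpack out l = q.unpack out l := by
  rcases N.cutOff_eq_or tmin q with h | ⟨i, -, -, h⟩ <;> rw [h]
  cases q <;> rfl

theorem cutOff_last_le (tmin : ℕ∞) (q : QueueEntry Trip) : (N.cutOff tmin q).last ≤ q.last := by
  rcases N.cutOff_eq_or tmin q with h | ⟨i, hi, -, h⟩ <;> rw [h]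
  rw [setLast_last]
  have := mem_exits.1 hi
  omega

/-- Exits that arrive before `tmin` are not cut off. -/
theorem mem_exits_cutOff {tmin : ℕ∞} {q : QueueEntry Trip} (h1 : 1 ≤ q.board)
    (h2 : q.last ≤ N.len (N.line q.trip)) {i : ℕ} (hi : i ∈ q.exits)
    (ha : (N.arr q.trip i : ℕ∞) < tmin) : i ∈ (N.cutOff tmin q).exits := by
  rw [mem_exits] at hi ⊢
  rw [cutOff_board]
  refine ⟨hi.1, ?_⟩
  rcases N.cutOff_eq_or tmin q with h | ⟨j, hj, hj', h⟩ <;> rw [h]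
  · exact hi.2
  · rw [setLast_last]
    by_contra hlt
    rw [mem_exits] at hj
    have : N.arr q.trip j ≤ N.arr q.trip i :=
      N.arr_mono _ (by omega) (by omega) (hi.2.trans h2)
    exact absurd (hj'.trans (by exact_mod_cast this)) (not_le.2 ha)

end Scan

/-! ### The TB query -/

section Query

variable {Stop Line Trip : Type*} [DecidableEq Stop]
  (N : Network Stop Line Trip) {𝔗 : Set ((Trip × ℕ) × (Trip × ℕ))} (ord : ScanOrder N 𝔗)

open Classical in
/-- The stop events that a TB query enters first. -/
noncomputable def tbRoots (s : Stop) (τ : ℕ) : List (Trip × ℕ) :=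
  (ord.foot s).flatMap fun p => ord.lines.flatMap fun ℓ =>
    ((List.range' 1 (N.len ℓ - 1)).filter fun i => decide (N.stopAt ℓ i = p)).flatMap fun i =>
      ((N.trips ℓ).find? fun T => decide ((τ : ℕ∞) + N.walk s p ≤ N.dep T i)).toList.map
        fun T => (T, i)

theorem mem_tbRoots {s : Stop} {τ : ℕ} {e : Trip × ℕ} (he : e ∈ N.tbRoots ord s τ) :
    1 ≤ e.2 ∧ (τ : ℕ∞) + N.walk s (N.stopOf e) ≤ N.dep e.1 e.2 := by
  simp only [tbRoots, List.mem_flatMap, List.mem_filter, List.mem_range'_1, List.mem_map,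
    Option.mem_toList, decide_eq_true_eq] at he
  obtain ⟨p, -, ℓ, -, i, ⟨⟨h1, -⟩, h2⟩, T, hT, rfl⟩ := he
  have hℓ := (N.mem_trips ℓ T).1 (List.mem_of_find?_eq_some hT)
  have hdep := List.find?_some hT
  refine ⟨h1, ?_⟩
  rw [decide_eq_true_eq] at hdep
  simp only [stopOf, hℓ, h2]
  exact hdep

/-- For every stop event that can be reached from the source, the same or an earlier trip of its
line is entered at the same index. -/
theorem exists_mem_tbRoots {s : Stop} {τ : ℕ} {f : Trip × ℕ} (h1 : 1 ≤ f.2)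
    (h2 : f.2 < N.len (N.line f.1)) (h : (τ : ℕ∞) + N.walk s (N.stopOf f) ≤ N.dep f.1 f.2) :
    ∃ T, N.PrecedesEq T f.1 ∧ (T, f.2) ∈ N.tbRoots ord s τ := by
  classical
  have hm : f.1 ∈ N.trips (N.line f.1) := (N.mem_trips _ _).2 rfl
  have hw : N.walk s (N.stopOf f) ≠ ⊤ := by
    intro htop
    rw [htop, add_top, top_le_iff] at h
    exact absurd h (ENat.natCast_ne_top _)
  obtain ⟨T, hT⟩ : ∃ T, ((N.trips (N.line f.1)).find? fun T =>
      decide ((τ : ℕ∞) + N.walk s (N.stopOf f) ≤ N.dep T f.2)) = some T := by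
    rw [← Option.isSome_iff_exists, List.find?_isSome]
    exact ⟨f.1, hm, by simpa using h⟩
  refine ⟨T, ?_, ?_⟩
  · obtain ⟨-, A, B, hAB, hA⟩ := List.find?_eq_some_iff_append.1 hT
    have hl : N.line T = N.line f.1 := (N.mem_trips _ _).1 (by rw [hAB]; simp)
    rw [← hl] at hAB
    have hm' : f.1 ∈ N.trips (N.line T) := (N.mem_trips _ _).2 hl.symm
    rw [hAB] at hm'
    rcases List.mem_append.1 hm' with hm' | hm'
    · have := hA _ hm'
      simp only [Bool.not_eq_true', decide_eq_false_iff_not] at this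
      exact absurd h this
    · rcases List.mem_cons.1 hm' with h' | h'
      · exact Or.inr h'.symm
      · exact Or.inl (N.precedes_of_append hAB h')
  · simp only [tbRoots, List.mem_flatMap, List.mem_filter, List.mem_range'_1, List.mem_map,
      Option.mem_toList, decide_eq_true_eq]
    refine ⟨N.stopOf f, (ord.mem_foot _ _).2 hw, N.line f.1, ord.mem_lines _, f.2,
      ⟨⟨h1, by omega⟩, rfl⟩, T, ?_, rfl⟩
    convert hT

variable [DecidableEq Trip]

theorem tbInit_eq_run (s : Stop) (τ : ℕ) :
    N.tbInit ord s τ = N.run N.emptyState ((N.tbRoots ord s τ).map fun e => (e, none)) := by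
  simp only [tbInit, run, tbRoots, List.foldl_flatMap, List.foldl_map]
  congr! 7
  funext σ i
  split
  · next h => rw [h]; rfl
  · next T h => rw [h]; rfl

theorem tbState_succ_fst (s t : Stop) (τ n : ℕ) : (N.tbState ord s t τ (n + 1)).1 =
    N.relax ord.out ((N.tbState ord s t τ n).1.queue.map
      (N.cutOff (N.tbState ord s t τ (n + 1)).2.tmin)) (N.tbState ord s t τ n).1.reached := rfl

theorem tbState_succ_snd (s t : Stop) (τ n : ℕ) : (N.tbState ord s t τ (n + 1)).2 =
    N.scanQueue t (n + 1) (N.tbState ord s t τ n).1.queue (N.tbState ord s t τ n).2 := rfl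

theorem tbState_isSearch (h𝔗 : ∀ t ∈ 𝔗, N.IsTransfer t.1 t.2) (s t : Stop) (τ : ℕ) :
    N.IsSearch ord.out (N.tbRoots ord s τ)
      (fun n => N.cutOff (N.tbState ord s t τ (n + 1)).2.tmin)
      (fun n => (N.tbState ord s t τ n).1) where
  zero := N.tbInit_eq_run ord s τ
  succ n := N.tbState_succ_fst ord s t τ n
  cut_trip _ q := N.cutOff_trip _ q
  cut_board _ q := N.cutOff_board _ q
  cut_last_le _ q := N.cutOff_last_le _ q
  cut_unpack _ q l := N.cutOff_unpack _ _ q l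
  one_le_of_mem_roots _ he := (N.mem_tbRoots ord he).1
  one_le_of_mem_out e f hf := (h𝔗 _ ((ord.mem_out e f).1 hf)).2.1.1

theorem tbState_tmin_anti (s t : Stop) (τ : ℕ) {m n : ℕ} (h : m ≤ n) :
    (N.tbState ord s t τ n).2.tmin ≤ (N.tbState ord s t τ m).2.tmin := by
  induction n, h using Nat.le_induction with
  | base => rfl
  | succ n _ ih =>
    rw [tbState_succ_snd]
    exact (N.scanQueue_tmin_le _ _ _ _).trans ih

theorem mem_front_tbState (s t : Stop) (τ n : ℕ) {c : FrontEntry Trip}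
    (hc : c ∈ (N.tbState ord s t τ n).2.front) :
    ∃ k A B, (N.tbState ord s t τ k).1.queue = A ++ c.entry :: B ∧ c.exit ∈ c.entry.exits ∧
      N.arrivalFrom t c.entry c.exit <
        (N.scanQueue t (k + 1) A (N.tbState ord s t τ k).2).tmin := by
  induction n with
  | zero => simp [tbState] at hc
  | succ n ih =>
    rw [tbState_succ_snd] at hc
    rcases N.mem_front_scanQueue _ _ _ _ hc with h | ⟨A, B, h⟩
    · exact ih h
    · exact ⟨n, A, B, h⟩

/-- A returned journey ends with an exit of a queue element such that the arrival time at the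
target improves on all exits examined before, and such that no exit of an earlier round that
arrives as early was cut off. -/
theorem TBReturns.exists_exit {N : Network Stop Line Trip} {ord : ScanOrder N 𝔗}
    (h𝔗 : ∀ t ∈ 𝔗, N.IsTransfer t.1 t.2) {s t : Stop} {τ : ℕ} {J : Journey Trip}
    (h : N.TBReturns ord s t τ J) :
    ∃ k A q B j, (N.tbState ord s t τ k).1.queue = A ++ q :: B ∧ q.board < j ∧ j ≤ q.last ∧
      J = q.unpack ord.out j ∧
      (∀ q' ∈ history (fun n => (N.tbState ord s t τ n).1) k ++ A, ∀ i, q'.board < i →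
        i ≤ q'.last → N.arrivalFrom t q j < N.arrivalFrom t q' i) ∧
      ∀ m < k, ∀ q' ∈ (N.tbState ord s t τ m).1.queue, ∀ i, q'.board < i → i ≤ q'.last →
        N.arr q'.trip i ≤ N.arr q.trip j →
        i ∈ (N.cutOff (N.tbState ord s t τ (m + 1)).2.tmin q').exits := by
  obtain ⟨n, -, c, hc, rfl⟩ := h
  obtain ⟨k, A, B, h1, h2, h3⟩ := N.mem_front_tbState ord s t τ n hc
  have hS := N.tbState_isSearch ord h𝔗 s t τ
  have hb : ∀ m, ∀ q ∈ (N.tbState ord s t τ m).1.queue,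
      1 ≤ q.board ∧ q.last ≤ N.len (N.line q.trip) := fun m q hq =>
    have := (hS.invariant m).bounds q (mem_history.2 ⟨m, by omega, hq⟩)
    ⟨this.1, this.2.2⟩
  refine ⟨k, A, c.entry, B, c.exit, h1, (mem_exits.1 h2).1, (mem_exits.1 h2).2, rfl, ?_, ?_⟩
  · intro q' hq' i hi1 hi2
    refine h3.trans_le ?_
    rcases List.mem_append.1 hq' with hq' | hq'
    · obtain ⟨m, hm, hq'⟩ := mem_history.1 hq'
      refine ((N.scanQueue_tmin_le _ _ _ _).trans (N.tbState_tmin_anti ord s t τ hm)).trans ?_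
      rw [tbState_succ_snd]
      exact N.scanQueue_tmin_le_arrivalFrom _ _ _ _ hq' (hb m q' hq').1 (hb m q' hq').2
        (mem_exits.2 ⟨hi1, hi2⟩)
    · have := hb k q' (by rw [h1]; exact List.mem_append_left _ hq')
      exact N.scanQueue_tmin_le_arrivalFrom _ _ _ _ hq' this.1 this.2 (mem_exits.2 ⟨hi1, hi2⟩)
  · intro m hm q' hq' i hi1 hi2 ha
    refine N.mem_exits_cutOff (hb m q' hq').1 (hb m q' hq').2 (mem_exits.2 ⟨hi1, hi2⟩) ?_
    calc (N.arr q'.trip i : ℕ∞) ≤ N.arr c.entry.trip c.exit := by exact_mod_cast ha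
      _ ≤ N.arrivalFrom t c.entry c.exit := le_self_add
      _ < _ := h3
      _ ≤ (N.tbState ord s t τ k).2.tmin := N.scanQueue_tmin_le _ _ _ _
      _ ≤ _ := N.tbState_tmin_anti ord s t τ hm

end Query

section EventSearch

variable {Stop Line Trip : Type*} [DecidableEq Trip]
  (N : Network Stop Line Trip) {𝔗 : Set ((Trip × ℕ) × (Trip × ℕ))} (ord : ScanOrder N 𝔗)

theorem eventTBState_isSearch (h𝔗 : ∀ t ∈ 𝔗, N.IsTransfer t.1 t.2) (ε : Trip × ℕ)
    (hε : 1 ≤ ε.2) :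
    N.IsSearch ord.out [ε] (fun _ q => q) (N.eventTBState ord ε) where
  zero := rfl
  succ _ := by rw [List.map_id']; rfl
  cut_trip _ _ := rfl
  cut_board _ _ := rfl
  cut_last_le _ _ := le_rfl
  cut_unpack _ _ _ := rfl
  one_le_of_mem_roots _ he := by rwa [List.mem_singleton.1 he]
  one_le_of_mem_out e f hf := (h𝔗 _ ((ord.mem_out e f).1 hf)).2.1.1

end EventSearch

/-! ### Comparing an event search with a query -/

section Comparison

variable {Stop Line Trip : Type*} [DecidableEq Trip] {N : Network Stop Line Trip}
  {out : Trip × ℕ → List (Trip × ℕ)} {roots : List (Trip × ℕ)}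
  {cut : ℕ → QueueEntry Trip → QueueEntry Trip} {σ E : ℕ → SearchState Trip}
  {scheme : GenScheme} {𝔗 : Set ((Trip × ℕ) × (Trip × ℕ))} {s : Stop} {τ a K : ℕ}

variable (N) in
/-- A search from the source stop `s` with departure time `τ` and the transfers `𝔗`, in which the
relaxations of the first `K` rounds skip no exit that arrives until `a`. -/
structure IsQuery (𝔗 : Set ((Trip × ℕ) × (Trip × ℕ))) (s : Stop) (τ a K : ℕ)
    (out : Trip × ℕ → List (Trip × ℕ)) (roots : List (Trip × ℕ))
    (cut : ℕ → QueueEntry Trip → QueueEntry Trip) (σ : ℕ → SearchState Trip) : Prop where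
  search : N.IsSearch out roots cut σ
  mem_out : ∀ e f, f ∈ out e ↔ (e, f) ∈ 𝔗
  walk_le_dep : ∀ e ∈ roots, (τ : ℕ∞) + N.walk s (N.stopOf e) ≤ N.dep e.1 e.2
  exists_root : ∀ f : Trip × ℕ, 1 ≤ f.2 → f.2 < N.len (N.line f.1) →
    (τ : ℕ∞) + N.walk s (N.stopOf f) ≤ N.dep f.1 f.2 →
      ∃ T, N.PrecedesEq T f.1 ∧ (T, f.2) ∈ roots
  mem_cut : ∀ m < K, ∀ q ∈ (σ m).queue, ∀ i, q.board < i → i ≤ q.last → N.arr q.trip i ≤ a →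
    i ∈ (cut m q).exits

namespace IsQuery

theorem isHistory (h : N.IsQuery 𝔗 s τ a K out roots cut σ) (n : ℕ) :
    N.IsHistory 𝔗 s τ (history σ (n + 1)) :=
  h.search.isHistory (fun e f => (h.mem_out e f).1) h.walk_le_dep n

theorem isHistory_append (h : N.IsQuery 𝔗 s τ a K out roots cut σ) {n : ℕ}
    {A B : List (QueueEntry Trip)} (hA : (σ n).queue = A ++ B) :
    N.IsHistory 𝔗 s τ (history σ n ++ A) := by
  have := h.isHistory n
  rw [history, hA, ← List.append_assoc] at this
  exact this.of_append

theorem covers_source (h : N.IsQuery 𝔗 s τ a K out roots cut σ) {f : Trip × ℕ} (h1 : 1 ≤ f.2)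
    (hf : (τ : ℕ∞) + N.walk s (N.stopOf f) ≤ N.dep f.1 f.2) {l : ℕ} (hl : f.2 < l)
    (hlen : l ≤ N.len (N.line f.1)) (n : ℕ) : N.Covers (history σ (n + 1)) f.1 l := by
  obtain ⟨T, hT, hr⟩ := h.exists_root f h1 (by omega) hf
  have hR : (σ 0).reached T ≤ f.2 + 1 := by
    rw [h.search.zero]
    exact N.run_reached_le_of_mem _
      (List.mem_map.2 ⟨(T, f.2), hr, rfl⟩ : (((T, f.2), none) : Op Trip) ∈ _)
  exact (((h.search.invariant 0).covers T l (hR.trans hl) (by rwa [hT.line_eq])).trans hT).mono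
    (history_subset (by omega))

/-- The first `n + 1` rounds explore what is necessary from the first `n` rounds. -/
theorem isExpansion_history (h : N.IsQuery 𝔗 s τ a K out roots cut σ) {n : ℕ} (hn : n ≤ K) :
    N.IsExpansion 𝔗 s τ a (history σ n) (history σ (n + 1)) where
  mono := history_subset (by omega)
  transfers q hq i h1 h2 ha f hf l hl hlen := by
    obtain ⟨m, hm, hq⟩ := mem_history.1 hq
    exact (h.search.covers_of_mem_out hq (h.mem_cut m (by omega) q hq i h1 h2 ha)
      ((h.mem_out _ _).2 hf) hl hlen).mono (history_subset (by omega))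
  source _ h1 hf _ hl hlen := h.covers_source h1 hf hl hlen n

/-- In the midst of a round, what is necessary is explored from the elements relaxed so far. -/
theorem isExpansion_append (h : N.IsQuery 𝔗 s τ a K out roots cut σ) {n : ℕ} (hn : n < K)
    {A B : List (QueueEntry Trip)} (hA : (σ n).queue = A ++ B) {ops ops' : List (Op Trip)}
    (hops : requests out ((σ n).queue.map (cut n)) = ops ++ ops')
    (hAops : ∀ o ∈ requests out (A.map (cut n)), o ∈ ops) :
    N.IsExpansion 𝔗 s τ a (history σ n ++ A)
      (history σ (n + 1) ++ (N.run ⟨(σ n).reached, []⟩ ops).queue) where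
  mono q hq := by
    refine List.mem_append_left _ ?_
    rw [history, hA, ← List.append_assoc]
    exact List.mem_append_left _ hq
  transfers q hq i h1 h2 ha f hf l hl hlen := by
    rcases List.mem_append.1 hq with hq | hq
    · exact ((h.isExpansion_history hn.le).transfers q hq i h1 h2 ha f hf l hl hlen).mono
        fun q hq => List.mem_append_left _ hq
    · have hi := h.mem_cut n hn q (by rw [hA]; exact List.mem_append_left _ hq) i h1 h2 ha
      exact h.search.covers_of_mem_requests hops (o := (f, some (cut n q)))
        (hAops _ (mem_requests.2 ⟨cut n q, List.mem_map_of_mem hq, i, hi, f, by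
          rw [h.search.cut_trip]; exact (h.mem_out _ _).2 hf, rfl⟩)) hl hlen
  source _ h1 hf _ hl hlen :=
    (h.covers_source h1 hf hl hlen n).mono fun q hq => List.mem_append_left _ hq

end IsQuery

theorem unpack_eq_append (out : Trip × ℕ → List (Trip × ℕ)) (q : QueueEntry Trip) (l : ℕ) :
    ∃ J, q.unpack out l = J ++ [⟨q.trip, q.board, l⟩] := by
  cases q with
  | root T b k => exact ⟨[], rfl⟩
  | child p T b k => exact ⟨_, rfl⟩

theorem unpack_child {p : QueueEntry Trip} {T : Trip} {b k l : ℕ} {is is' : List ℕ} {i : ℕ}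
    (hp : p.exits = is ++ i :: is') (hi : (T, b) ∈ out (p.trip, i))
    (his : ∀ c ∈ is, (T, b) ∉ out (p.trip, c)) :
    (QueueEntry.child p T b k).unpack out l = p.unpack out i ++ [⟨T, b, l⟩] := by
  have : (p.exits.find? fun i => decide ((T, b) ∈ out (p.trip, i))) = some i :=
    List.find?_eq_some_iff_append.2 ⟨by simpa using hi, is, is', hp, by simpa using his⟩
  rw [QueueEntry.unpack, this, Option.getD_some]

theorem IsSearch.one_le_board_of_mem_unpack (h : N.IsSearch out roots cut σ) {k : ℕ}
    {q : QueueEntry Trip} (hq : q ∈ (σ k).queue) (l : ℕ) :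
    ∀ v ∈ q.unpack out l, 1 ≤ v.board := by
  induction k generalizing q l with
  | zero =>
    obtain ⟨e, he, m, rfl⟩ := h.mem_queue_zero hq
    simpa [QueueEntry.unpack] using h.one_le_of_mem_roots e he
  | succ k ih =>
    obtain ⟨A, B, hAB⟩ := List.append_of_mem hq
    obtain ⟨A₀, q₀, B₀, is, i, is', fs, f, fs', ops', h1, h2, h3, ops, h4, h5, h6, h7, h8⟩ :=
      h.exists_parent hAB
    intro v hv
    rw [h8, QueueEntry.unpack, h.cut_unpack, List.mem_append] at hv
    rcases hv with hv | hv
    · exact ih (by simp [h1]) _ v hv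
    · rw [List.mem_singleton] at hv
      rw [hv]
      exact h.one_le_of_mem_out (q₀.trip, i) f (by simp [h3])

/-- The relaxation that leads to an element of the queue takes place at the first exit of the
parent element with a transfer to the event where the trip is entered, since afterwards this trip
is not entered at this index again. -/
theorem not_mem_out_of_lt_reached {q : QueueEntry Trip} {is : List ℕ} {f : Trip × ℕ}
    {R : Trip → ℕ} {ops ops₁ ops₂ : List (Op Trip)}
    (hops : ops = ops₁ ++ (exitRequests out q is ++ ops₂))
    (hf : f.2 + 1 < (N.run ⟨R, []⟩ ops).reached f.1) : ∀ c ∈ is, f ∉ out (q.trip, c) := by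
  intro c hc hfc
  refine absurd (N.run_reached_le_of_mem ⟨R, []⟩ (o := (f, some q)) (ops := ops) ?_)
    (not_le.2 hf)
  rw [hops]
  exact List.mem_append_right _ (List.mem_append_left _ (mem_exitRequests.2 ⟨c, hc, f, hfc, rfl⟩))

theorem run_queue_eq_append {R : Trip → ℕ} {ops ops' : List (Op Trip)} {o : Op Trip}
    (h : o.1.2 + 1 < (N.run ⟨R, []⟩ ops).reached o.1.1) :
    ∃ B, (N.run ⟨R, []⟩ (ops ++ o :: ops')).queue = (N.run ⟨R, []⟩ ops).queue ++
      makeEntry o.1.1 o.1.2 ((N.run ⟨R, []⟩ ops).reached o.1.1 - 1) o.2 :: B := by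
  rw [run_append, run_cons, N.enqueue_of_lt h, run_history]
  dsimp only
  rw [List.append_assoc]
  exact ⟨_, rfl⟩

/-- Going back from an element of the query to its parent, for an exit that is not dominated by
what was explored before: the exit by which the parent is left is not dominated either. -/
theorem IsQuery.exists_parent (h : N.IsQuery 𝔗 s τ a K out roots cut σ)
    (h𝔗 : N.IsTransferSet scheme 𝔗) (hdwell : scheme = .earliestTrip → N.DwellNonneg)
    {n : ℕ} (hn : n < K) {A B : List (QueueEntry Trip)} {q : QueueEntry Trip}
    (hq : (σ (n + 1)).queue = A ++ q :: B) {j : ℕ} (hj : q.board < j) (hj' : j ≤ q.last)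
    (ha : N.arr q.trip j ≤ a)
    (hdom : ¬ N.Dominated scheme s τ (history σ (n + 1) ++ A) (q.trip, j)) :
    ∃ A₀ q₀ B₀ is i is' fs fs' ops ops', (σ n).queue = A₀ ++ q₀ :: B₀ ∧
      (cut n q₀).exits = is ++ i :: is' ∧ out (q₀.trip, i) = fs ++ (q.trip, q.board) :: fs' ∧
      ops = requests out (A₀.map (cut n)) ++ (exitRequests out (cut n q₀) is ++
        fs.map fun f => (f, some (cut n q₀))) ∧
      requests out ((σ n).queue.map (cut n)) = ops ++ ops' ∧
      (N.run ⟨(σ n).reached, []⟩ ops).queue = A ∧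
      (∀ c ∈ is, (q.trip, q.board) ∉ out (q₀.trip, c)) ∧
      q.unpack out j = q₀.unpack out i ++ [⟨q.trip, q.board, j⟩] ∧
      q₀.board < i ∧ i ≤ q₀.last ∧ N.arr q₀.trip i ≤ a ∧
      ¬ N.Dominated scheme s τ (history σ n ++ A₀) (q₀.trip, i) := by
  obtain ⟨A₀, q₀, B₀, is, i, is', fs, f, fs', ops', h1, h2, h3, ops, h4, h5, h6, h7, h8⟩ :=
    h.search.exists_parent hq
  have hlen : q.last ≤ N.len (N.line q.trip) :=
    ((h.isHistory (n + 1)).bounds q (mem_history_succ hq)).2.2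
  have hf : f = (q.trip, q.board) := by rw [h8]; rfl
  have hfirst := not_mem_out_of_lt_reached h4 h7
  have hi := h.search.mem_exits_of_cut (n := n) (q := q₀) (i := i) (by simp [h2])
  have hfi : f ∈ out (q₀.trip, i) := by simp [h3]
  have ht : N.IsTransfer (q₀.trip, i) f :=
    (IsTransferSet.isCandidate N h𝔗 ((h.mem_out _ _).1 hfi)).1
  rw [h.search.cut_trip] at hfirst
  refine ⟨A₀, q₀, B₀, is, i, is', fs, fs', ops, _, h1, h2, hf ▸ h3, h4, h5, h6, hf ▸ hfirst, ?_,
    hi.1, hi.2, ?_, ?_⟩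
  · rw [h8, unpack_child h2 (by rwa [h.search.cut_trip]) (by rwa [h.search.cut_trip]),
      h.search.cut_unpack]
    rfl
  · subst hf
    exact (ht.arr_le_arr hj (hj'.trans hlen)).trans ha
  · intro hd
    have hE := h.isExpansion_append hn h1 h5
      fun o ho => by rw [h4]; exact List.mem_append_left _ ho
    rw [h6] at hE
    subst hf
    exact hdom (hd.transfer h𝔗 hdwell (h.isHistory_append h1) hE ht hj (hj'.trans hlen) ha)

/-- All later exits of the given elements up to the arrival time `a` are dominated by `H`. -/
def AllDominated (N : Network Stop Line Trip) (scheme : GenScheme) (s : Stop) (τ a : ℕ)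
    (Q H : List (QueueEntry Trip)) : Prop :=
  ∀ q ∈ Q, ∀ l, q.board < l → l ≤ N.len (N.line q.trip) → N.arr q.trip l ≤ a →
    N.Dominated scheme s τ H (q.trip, l)

/-- The event search from `T[x]`, where the trip segment `u` of `T` is part of the journey unpacked
from the exit `j` of the query element `q`, keeps pace with the query: it reaches an element `Q`
that corresponds to `q`, and everything that it explores before `Q` is dominated by what the
query explores before `q`.  Otherwise the exit `j` of `q` would be dominated. -/
theorem IsQuery.exists_tracking (h : N.IsQuery 𝔗 s τ a K out roots cut σ)
    (h𝔗 : N.IsTransferSet scheme 𝔗) (hdwell : scheme = .earliestTrip → N.DwellNonneg)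
    {u : TripSegment Trip} {x : ℕ} (hx : u.board ≤ x) (hx' : x < u.exit)
    (hE : N.IsSearch out [(u.trip, x)] (fun _ q => q) E) (P : Journey Trip) :
    ∀ (n : ℕ), n ≤ K → ∀ (A : List (QueueEntry Trip)) (q : QueueEntry Trip)
      (B : List (QueueEntry Trip)) (j : ℕ) (M : Journey Trip),
      (σ n).queue = A ++ q :: B → q.board < j → j ≤ q.last → N.arr q.trip j ≤ a →
      ¬ N.Dominated scheme s τ (history σ n ++ A) (q.trip, j) →
      q.unpack out j = P ++ u :: M →
      ∃ A' Q B' L, (E M.length).queue = A' ++ Q :: B' ∧ Q.trip = q.trip ∧ q.board ≤ Q.board ∧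
        Q.board < j ∧ j ≤ Q.last ∧ ⟨u.trip, x, u.exit⟩ :: M = L ++ [⟨Q.trip, Q.board, j⟩] ∧
        (∀ l, Q.unpack out l = L ++ [⟨Q.trip, Q.board, l⟩]) ∧
        N.AllDominated scheme s τ a (history E (M.length + 1)) (history σ (n + 1)) ∧
        N.AllDominated scheme s τ a A' (history σ n ++ A) := by
  intro n
  induction n with
  | zero | succ n ih
  all_goals
    intro hnK A q B j M hq hj hj' ha hdom hM
    have hqh := mem_history_succ hq
    have hlen : q.last ≤ N.len (N.line q.trip) := ((h.isHistory _).bounds q hqh).2.2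
    rcases List.eq_nil_or_concat' M with rfl | ⟨M, w, rfl⟩
  case zero.inl | succ.inl =>
    -- the first round of the event search
    obtain ⟨J, hJ⟩ := unpack_eq_append out q j
    obtain ⟨-, hu⟩ := List.append_inj' (hJ.symm.trans hM) rfl
    rw [List.cons.injEq] at hu
    obtain ⟨rfl, -⟩ := hu
    dsimp only at hx hx' hE ⊢
    have hE0 : (E 0).queue = [QueueEntry.root q.trip x (N.len (N.line q.trip))] := by
      rw [hE.zero, List.map_singleton, run_cons, run_nil, N.enqueue_of_lt]
      · rfl
      · simp only [emptyState]
        omega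
    refine ⟨[], _, [], [], hE0, rfl, hx, hx', hj'.trans hlen, rfl, fun l => rfl, ?_, by
      simp [AllDominated]⟩
    intro Q hQ l hl hl' _
    have : Q = QueueEntry.root q.trip x (N.len (N.line q.trip)) := by
      simpa [history, hE0] using hQ
    subst this
    exact ((h.isHistory _).covers hqh (lt_of_le_of_lt hx hl) hl').dominated hl'
  case zero.inr =>
    -- an element of the first round is not unpacked to several trip segments
    obtain ⟨e, -, m, rfl⟩ := h.search.mem_queue_zero (q := q) (by simp [hq])
    have := congrArg List.length hM
    simp [QueueEntry.unpack] at this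
    omega
  case succ.inr =>
    obtain ⟨A₀, q₀, B₀, is, i, is', fs, fs', ops, ops', h1, h2, h3, h4, h5, h6, h7, h8, h9, h10,
      h11, h12⟩ := h.exists_parent h𝔗 hdwell hnK hq hj hj' ha hdom
    have hM' : q₀.unpack out i = P ++ u :: M ∧ [⟨q.trip, q.board, j⟩] = [w] :=
      List.append_inj' (h8.symm.trans (hM.trans (by simp))) rfl
    obtain ⟨hM', hw⟩ := hM'
    obtain rfl : ⟨q.trip, q.board, j⟩ = w := by simpa using hw
    obtain ⟨A', Q, B', L, g1, g2, g3, g4, g5, g6, g7, g8, g9⟩ :=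
      ih (by omega) A₀ q₀ B₀ i M h1 h9 h10 h11 h12 hM'
    have hE' := h.isExpansion_append hnK h1 h5
      fun o ho => by rw [h4]; exact List.mem_append_left _ ho
    rw [h6] at hE'
    have htr : ∀ {e f : Trip × ℕ}, f ∈ out e → N.IsTransfer e f := fun {e f} hf =>
      (IsTransferSet.isCandidate N h𝔗 ((h.mem_out e f).1 hf)).1
    -- the requests of the event search before the one that leads to the next element
    obtain ⟨isE, isE', hQ⟩ := List.append_of_mem (mem_exits.2 ⟨g4, g5⟩)
    have hisE : ∀ c ∈ isE, c ∈ is := fun c hc => by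
      have := (mem_left_of_exits_eq hQ c).1 hc
      exact (mem_left_of_exits_eq h2 c).2 ⟨by rw [h.search.cut_board]; omega, this.2⟩
    obtain ⟨opsE', hopsE⟩ := requests_append_cons out (A := A') (B := B') hQ (g2 ▸ h3)
    rw [← g1] at hopsE
    set opsE := requests out A' ++ (exitRequests out Q isE ++ fs.map fun f => (f, some Q))
      with hopsE_def
    have hcov : ∀ f p, (f, p) ∈ ops → ∀ l, f.2 < l → l ≤ N.len (N.line f.1) →
        N.Dominated scheme s τ (history σ (n + 1) ++ A) (f.1, l) := fun f p hf l hl hl' => by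
      have := h.search.covers_of_mem_requests h5 hf hl hl'
      rw [h6] at this
      exact this.dominated hl'
    have hreq : ∀ o ∈ opsE, ∀ l, o.1.2 < l → l ≤ N.len (N.line o.1.1) → N.arr o.1.1 l ≤ a →
        N.Dominated scheme s τ (history σ (n + 1) ++ A) (o.1.1, l) := by
      intro o ho l hl hl' hal
      rw [hopsE_def, List.mem_append, List.mem_append] at ho
      rcases ho with ho | ho | ho
      · obtain ⟨Q', hQ', c, hc, f, hf, rfl⟩ := mem_requests.1 ho
        have ht := htr hf
        exact (g9 Q' hQ' c (mem_exits.1 hc).1 ht.1.2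
          ((ht.arr_le_arr hl hl').trans hal)).transfer h𝔗 hdwell (h.isHistory_append h1) hE' ht
            hl hl' hal
      · obtain ⟨c, hc, f, hf, rfl⟩ := mem_exitRequests.1 ho
        refine hcov f (some (cut n q₀)) ?_ l hl hl'
        rw [h4]
        refine List.mem_append_right _ (List.mem_append_left _ (mem_exitRequests.2
          ⟨c, hisE c hc, f, ?_, rfl⟩))
        rwa [h.search.cut_trip, ← g2]
      · obtain ⟨f, hf, rfl⟩ := List.mem_map.1 ho
        refine hcov f (some (cut n q₀)) ?_ l hl hl'
        rw [h4]
        exact List.mem_append_right _ (List.mem_append_right _ (List.mem_map.2 ⟨f, hf, rfl⟩))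
    have hnew : N.AllDominated scheme s τ a (N.run ⟨(E M.length).reached, []⟩ opsE).queue
        (history σ (n + 1) ++ A) := by
      intro Q' hQ' l hl hl' hal
      obtain ⟨C, D, hCD⟩ := List.append_of_mem hQ'
      obtain ⟨o₁, o, o₂, ho, -, -, rfl⟩ := N.exists_op_of_queue_eq _ _ hCD
      rw [makeEntry_trip] at hl' hal ⊢
      rw [makeEntry_board] at hl
      exact hreq o (by rw [ho]; simp) l hl hl' hal
    have hmapE : (E M.length).queue.map (fun q => q) = (E M.length).queue := List.map_id' _
    -- the trip is not blocked
    have hlt : j < (N.run ⟨(E M.length).reached, []⟩ opsE).reached q.trip := by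
      by_contra hle
      obtain ⟨Q', hQ', k1, k2, k3⟩ :=
        (hE.invariant_run M.length (ops := opsE) (by rw [hmapE]; exact hopsE)).covers q.trip j
          (not_lt.1 hle) (hj'.trans hlen)
      have hjQ : j ≤ N.len (N.line Q'.trip) := by rw [k1.line_eq]; exact hj'.trans hlen
      have hw := k1.walksTo (by omega) hjQ
      have haQ : N.arr Q'.trip j ≤ a := hw.le.trans ha
      refine hdom (Dominated.trans (e := (Q'.trip, j)) ?_ hw)
      rcases List.mem_append.1 hQ' with hQ' | hQ'
      · exact (g8 Q' hQ' j k2 hjQ haQ).mono fun q hq => List.mem_append_left _ hq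
      · exact hnew Q' hQ' j k2 hjQ haQ
    obtain ⟨B'', hB''⟩ := run_queue_eq_append (N := N) (R := (E M.length).reached) (ops := opsE)
      (ops' := opsE') (o := ((q.trip, q.board), some Q)) (by dsimp only; omega)
    rw [← hopsE, ← hmapE, ← hE.queue_succ] at hB''
    have hQfirst : ∀ c ∈ isE, (q.trip, q.board) ∉ out (Q.trip, c) := fun c hc => by
      rw [g2]
      exact h7 c (hisE c hc)
    have hQi : (q.trip, q.board) ∈ out (Q.trip, i) := by rw [g2, h3]; simp
    rw [List.length_append, List.length_singleton]
    refine ⟨_, _, B'', ⟨u.trip, x, u.exit⟩ :: M, hB'', by simp, by simp, by simpa using hj, ?_,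
      by simp, ?_, ?_, hnew⟩
    · rw [makeEntry_last]
      dsimp only
      omega
    · intro l
      rw [makeEntry_trip, makeEntry_board, g6, ← g7]
      exact unpack_child hQ hQi hQfirst
    · intro Q' hQ' l hl hl' hal
      rw [history, List.mem_append] at hQ'
      rcases hQ' with hQ' | hQ'
      · exact (g8 Q' hQ' l hl hl' hal).mono (history_subset (by omega))
      · obtain ⟨C, D, hCD⟩ := List.append_of_mem hQ'
        obtain ⟨A₁, Q₁, B₁, is₁, c, is₁', fs₁, f, fs₁', -, k1, k2, k3, ops₁, -, -, -,
          -, k8⟩ :=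
          hE.exists_parent hCD
        have hQ₁ : Q₁ ∈ history E (M.length + 1) :=
          mem_history.2 ⟨M.length, by omega, by simp [k1]⟩
        have hc := (mem_exits (q := Q₁) (i := c)).1 (by simp [k2])
        have ht : N.IsTransfer (Q₁.trip, c) f := htr (by simp [k3])
        rw [k8] at hl hl' hal ⊢
        exact (g8 Q₁ hQ₁ c hc.1 ht.1.2 ((ht.arr_le_arr hl hl').trans hal)).transfer h𝔗 hdwell
          (h.isHistory n) (h.isExpansion_history hnK) ht hl hl' hal

/-- The event search from `T[x]`, where the trip segment `u` of `T` is part of the journey unpacked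
from an exit of a query element that is not dominated, finds all subjourneys. -/
theorem IsQuery.exists_unpack_eq (h : N.IsQuery 𝔗 s τ a K out roots cut σ)
    (h𝔗 : N.IsTransferSet scheme 𝔗) (hdwell : scheme = .earliestTrip → N.DwellNonneg)
    {u : TripSegment Trip} {x : ℕ} (hx : u.board ≤ x) (hx' : x < u.exit)
    (hE : N.IsSearch out [(u.trip, x)] (fun _ q => q) E) (P M : Journey Trip) {n : ℕ}
    (hn : n ≤ K) {A : List (QueueEntry Trip)} {q : QueueEntry Trip}
    {B : List (QueueEntry Trip)} {j : ℕ} (S : Journey Trip)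
    (hq : (σ n).queue = A ++ q :: B) (hj : q.board < j) (hj' : j ≤ q.last)
    (ha : N.arr q.trip j ≤ a)
    (hdom : ¬ N.Dominated scheme s τ (history σ n ++ A) (q.trip, j))
    (hM : q.unpack out j = P ++ u :: M ++ S) :
    ∃ Q ∈ (E M.length).queue, ∃ L i, Q.board < i ∧ i ≤ Q.last ∧
      ⟨u.trip, x, u.exit⟩ :: M = L ++ [⟨Q.trip, Q.board, i⟩] ∧
      ∀ l, Q.unpack out l = L ++ [⟨Q.trip, Q.board, l⟩] := by
  induction n generalizing A q B j S with
  | zero | succ n ih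
  all_goals rcases List.eq_nil_or_concat' S with rfl | ⟨S, w, rfl⟩
  case zero.inl | succ.inl =>
    obtain ⟨A', Q, B', L, g1, g2, g3, g4, g5, g6, g7, -⟩ :=
      h.exists_tracking h𝔗 hdwell hx hx' hE P _ hn A q B j M hq hj hj' ha hdom (by simpa using hM)
    exact ⟨Q, by simp [g1], L, j, g4, g5, g6, g7⟩
  case zero.inr =>
    obtain ⟨e, -, m, rfl⟩ := h.search.mem_queue_zero (q := q) (by simp [hq])
    have := congrArg List.length hM
    simp [QueueEntry.unpack] at this
    omega
  case succ.inr =>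
    obtain ⟨A₀, q₀, B₀, is, i, is', fs, fs', ops, ops', h1, h2, h3, h4, h5, h6, h7, h8, h9, h10,
      h11, h12⟩ := h.exists_parent h𝔗 hdwell hn hq hj hj' ha hdom
    have hM' : q₀.unpack out i = P ++ u :: M ++ S ∧ [⟨q.trip, q.board, j⟩] = [w] :=
      List.append_inj' (h8.symm.trans (hM.trans (by simp))) rfl
    exact ih (by omega) S h1 h9 h10 h11 h12 hM'.1

end Comparison

/-! ### Subjourneys of a returned journey -/

section Subjourney

variable {Stop Line Trip : Type*} [DecidableEq Trip] {N : Network Stop Line Trip}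
  {𝔗 : Set ((Trip × ℕ) × (Trip × ℕ))} {ord : ScanOrder N 𝔗}

/-- An event search finds at most one journey for each stop event. -/
theorem EventTBFinds.unique (h𝔗 : ∀ t ∈ 𝔗, N.IsTransfer t.1 t.2) {εs εt : Trip × ℕ}
    (hεs : 1 ≤ εs.2) {n n' : ℕ} {L L' : Journey Trip} (h : N.EventTBFinds ord εs n εt L)
    (h' : N.EventTBFinds ord εs n' εt L') : n = n' ∧ L = L' := by
  have hE := N.eventTBState_isSearch ord h𝔗 εs hεs
  -- the earlier rounds are disjoint from each round
  have hdisj : ∀ {m m' : ℕ} {q q' : QueueEntry Trip}, q ∈ (N.eventTBState ord εs m).queue →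
      q' ∈ (N.eventTBState ord εs m').queue → q.trip = q'.trip → q.board < εt.2 →
      εt.2 ≤ q'.last → ¬ m < m' := by
    intro m m' q q' hq hq' ht h1 h2 hlt
    obtain ⟨A, B, hAB⟩ := List.append_of_mem hq'
    have := (hE.invariant m').disjoint (history (N.eventTBState ord εs) m' ++ A) q' B
      (by simp [history, hAB]) q (List.mem_append_left _ (mem_history.2 ⟨m, hlt, hq⟩)) ht
    omega
  obtain ⟨m, rfl, q, hq, h1, h2, h3, rfl⟩ := h
  obtain ⟨m', rfl, q', hq', h1', h2', h3', rfl⟩ := h'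
  have ht : q.trip = q'.trip := h1.trans h1'.symm
  have hm : m = m' := le_antisymm (not_lt.1 (hdisj hq' hq ht.symm h2' h3))
    (not_lt.1 (hdisj hq hq' ht h2 h3'))
  subst hm
  have : q = q' := (hE.invariant m).unique (mem_history.2 ⟨m, by omega, hq⟩)
    (mem_history.2 ⟨m, by omega, hq'⟩) ht h2 h3 h2' h3'
  exact ⟨rfl, by rw [this]⟩

end Subjourney

end Network

theorem theorem1 {Stop Line Trip : Type*}
    [DecidableEq Stop] [DecidableEq Trip]
    (N : Network Stop Line Trip) (scheme : GenScheme)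
    (𝔗 : Set ((Trip × ℕ) × (Trip × ℕ))) (h𝔗 : N.IsTransferSet scheme 𝔗)
    (ord : ScanOrder N 𝔗)
    (s t : Stop) (τ : ℕ) (J : Journey Trip) (hJ : N.TBReturns ord s t τ J)
    (hearliest : scheme = GenScheme.earliestTrip →
      N.DwellNonneg ∧ N.arrivalAt t J < (τ : ℕ∞) + N.walk s t)
    (εs εt : Trip × ℕ) (K : Journey Trip) (hK : IsEventSubjourney J εs εt K) :
    ∀ (n : ℕ) (L : Journey Trip), N.EventTBFinds ord εs n εt L ↔ n = K.length ∧ L = K := by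
  open Network in
  have hT : ∀ t ∈ 𝔗, N.IsTransfer t.1 t.2 := fun t ht => (IsTransferSet.isCandidate N h𝔗 ht).1
  obtain ⟨k, A, q, B, j, hq, hj, hj', rfl, hbest, hcut⟩ := hJ.exists_exit hT
  have hQ : N.IsQuery 𝔗 s τ (N.arr q.trip j) k ord.out (N.tbRoots ord s τ) _
      (fun n => (N.tbState ord s t τ n).1) :=
    ⟨N.tbState_isSearch ord hT s t τ, ord.mem_out, fun e he => (N.mem_tbRoots ord he).2,
      fun f h1 h2 h3 => N.exists_mem_tbRoots ord h1 h2 h3, hcut⟩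
  have harr : N.arrivalAt t (q.unpack ord.out j) = N.arrivalFrom t q j := by
    obtain ⟨L, hL⟩ := unpack_eq_append ord.out q j
    rw [hL]
    simp [arrivalAt, arrivalFrom]
  -- the last exit is not dominated: otherwise the journey would not improve on what was found
  -- before, or on walking
  have hdom : ¬ N.Dominated scheme s τ
      (history (fun n => (N.tbState ord s t τ n).1) k ++ A) (q.trip, j) := by
    have hwalk : ∀ {θ : ℕ} {p : Stop}, N.WalksTo θ p (q.trip, j) →
        (θ : ℕ∞) + N.walk p t ≤ N.arrivalFrom t q j := fun {θ p} hw => by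
      calc (θ : ℕ∞) + N.walk p t
          ≤ θ + (N.walk p (N.stopOf (q.trip, j)) + N.walk (N.stopOf (q.trip, j)) t) := by
            gcongr; exact N.walk_triangle _ _ _
        _ = θ + N.walk p (N.stopOf (q.trip, j)) + N.walk (N.stopOf (q.trip, j)) t :=
            (add_assoc _ _ _).symm
        _ ≤ _ := by unfold arrivalFrom; gcongr; exact hw
    rintro (⟨hs, hw⟩ | ⟨q', hq', i, h1, h2, hw⟩)
    · have := (hearliest hs).2
      rw [harr] at this
      exact absurd (hwalk hw) (not_le.2 this)
    · exact absurd (hwalk hw) (not_le.2 (hbest q' hq' i h1 h2))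
  have hboard := hQ.search.one_le_board_of_mem_unpack (k := k) (q := q) (by simp [hq]) j
  -- it suffices that the subjourney is found
  suffices hfind : 1 ≤ εs.2 ∧ N.EventTBFinds ord εs K.length εt K by
    intro n L
    constructor
    · exact fun h => h.unique hT hfind.1 hfind.2
    · rintro ⟨rfl, rfl⟩
      exact hfind.2
  have key : ∀ (P M S : Journey Trip) (u : TripSegment Trip) (x : ℕ),
      q.unpack ord.out j = P ++ u :: M ++ S → u.board ≤ x → x < u.exit →
      1 ≤ x ∧ ∃ Q ∈ (N.eventTBState ord (u.trip, x) M.length).queue, ∃ L i, Q.board < i ∧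
        i ≤ Q.last ∧ ⟨u.trip, x, u.exit⟩ :: M = L ++ [⟨Q.trip, Q.board, i⟩] ∧
        ∀ l, Q.unpack ord.out l = L ++ [⟨Q.trip, Q.board, l⟩] := by
    intro P M S u x hM hx hx'
    have h1 : 1 ≤ x := (hboard u (by rw [hM]; simp)).trans hx
    exact ⟨h1, hQ.exists_unpack_eq h𝔗 (fun h => (hearliest h).1) hx hx'
      (N.eventTBState_isSearch ord hT (u.trip, x) h1) P M le_rfl S hq hj hj' le_rfl hdom hM⟩
  cases hK with
  | within P S u x y hJ hx hxy hy =>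
    obtain ⟨h1, Q, hQm, L, i, h2, h3, h4, h5⟩ := key P [] S u x (by simp [hJ]) hx (by omega)
    obtain ⟨h6, h7⟩ := List.append_inj' (show [] ++ [_] = L ++ [_] from h4) rfl
    simp only [List.cons.injEq, TripSegment.mk.injEq, and_true] at h7
    obtain ⟨h7, h8, h9⟩ := h7
    refine ⟨h1, 0, rfl, Q, hQm, h7.symm, by dsimp only; omega, by dsimp only; omega, ?_⟩
    rw [h5, ← h6, ← h7, ← h8]
    rfl
  | across P M S u v x y hJ hx hx' hy hy' =>
    obtain ⟨h1, Q, hQm, L, i, h2, h3, h4, h5⟩ :=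
      key P (M ++ [v]) S u x (by simp [hJ]) hx hx'
    rw [← List.cons_append] at h4
    obtain ⟨h6, h7⟩ := List.append_inj' h4 rfl
    obtain rfl : v = ⟨Q.trip, Q.board, i⟩ := by simpa using h7
    dsimp only at hy hy'
    refine ⟨h1, (M ++ [(⟨Q.trip, Q.board, i⟩ : TripSegment Trip)]).length, by simp, Q, hQm, rfl,
      hy, hy'.trans h3, ?_⟩
    rw [h5, ← h6]
    rfl
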